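/- **Setting.** All Lie algebras are real Lie algebras with a Hausdorff locally convex topology for which the bracket is jointly continuous; all linear maps, multilinear forms and sections below are continuous. Fix such Lie algebras $\mathfrak f$ and $\mathfrak a$ with $\mathfrak a$ abelian. $H^3(\mathfrak f,\mathfrak a)$ denotes continuous Chevalley–Eilenberg cohomology with trivial coefficients, with differential $\delta\omega(X_1,\dots,X_{p+1})=\sum_{i<j}(-1)^{i+j}\omega([X_i,X_j],X_1,\dots,\widehat{X_i},\dots,\widehat{X_j},\dots,X_{p+1})$. $\mathrm{Sym}^2(\mathfrak f,\mathfrak a)^{\mathrm{ad}}$ is the space of continuous symmetric bilinear $B:\mathfrak f\times\mathfrak f\to\mathfrak a$ with $B([x,y],z)+B(y,[x,z])=0$, and $\mathrm{cw}:\mathrm{Sym}^2(\mathfrak f,\mathfrak a)^{\mathrm{ad}}\to H^3(\mathfrak f,\mathfrak a)$ sends $B$ to the class of $(x,y,z)\mapsto B([x,y],z)$. **Crossed modules.** A crossed module $\mathfrak G$ consists of a Lie algebra homomorphism $t:\mathfrak h\to\mathfrak g$ and a continuous action $\alpha$ of $\mathfrak g$ on $\mathfrak h$ by derivations with $t(\alpha(X,y))=[X,t(y)]$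 and $\alpha(t(x),y)=[x,y]$. It is central if $\mathfrak g$ acts trivially on $\ker t$, and smoothly separable if it admits a splitting, i.e. a continuous linear $u:\mathfrak g\to\mathfrak h$ with $tut=t$ and $utu=u$; a half splitting only satisfies $tut=t$. An object of $\mathfrak{CrMod}(\mathfrak f,\mathfrak a)$ is a central, smoothly separable crossed module with topological identifications $\ker t\cong\mathfrak a$ and $\mathfrak g/t(\mathfrak h)\cong\mathfrak f$, i.e. with an exact sequence $0\to\mathfrak a\xrightarrow{\iota}\mathfrak h\xrightarrow{t}\mathfrak g\xrightarrow{p}\mathfrak f\to0$, with $\iota$ a topological embedding and $p$ a quotient map. A section is a continuous linear $s:\mathfrak f\to\mathfrak g$ with $ps=\mathrm{id}$; a half splitting $u$ extends $s$ if $tu=\mathrm{id}-sp$. For a half splitting $u$ put $\rho^\perp=\mathrm{id}-tu$ and $\omega_u(X,Y)=\alpha(X,uY)-\alpha(Y,uX)-[uX,uY]+u[\rho^\perp X,\rho^\perp Y]$. There is a unique cocycle $C_u$ on $\mathfrak f$ with $\iota_*p^*C_u=\delta\omega_u$, and the Kassel–Loday class is $\mathrm{KL}(\mathfrak G)=[C_u]\in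 H^3(\mathfrak f,\mathfrak a)$. **Butterflies.** A butterfly $\mathfrak k:\mathfrak G_1\to\mathfrak G_2$ is a Lie algebra $\mathfrak k$ with continuous homomorphisms $i_a:\mathfrak h_a\to\mathfrak k$, $r_a:\mathfrak k\to\mathfrak g_a$ ($a=1,2$) such that $r_ai_a=t_a$, $r_2i_1=0$, $0\to\mathfrak h_2\xrightarrow{i_2}\mathfrak k\xrightarrow{r_1}\mathfrak g_1\to0$ is a topologically split short exact sequence, and $i_a(\alpha_a(r_aX,y))=[X,i_ay]$. It is invertible if $0\to\mathfrak h_1\xrightarrow{i_1}\mathfrak k\xrightarrow{r_2}\mathfrak g_2\to0$ is topologically split exact as well. Morphisms in $\mathfrak{CrMod}(\mathfrak f,\mathfrak a)$ are the invertible butterflies inducing the identities on $\mathfrak f$ and $\mathfrak a$, i.e. $p_2r_2=p_1r_1$ and $i_2\iota_2=-i_1\iota_1$. A section of $\mathfrak k$ is a continuous linear $q:\mathfrak g_1\to\mathfrak k$ with $r_1q=\mathrm{id}$; it determines $j:\mathfrak k\to\mathfrak h_2$ by $i_2j+qr_1=\mathrm{id}$, and $\phi_q=r_2q$, $f_q=-ji_1$,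 $\lambda_q(X,Y)=j[qX,qY]$. **Adjustments.** An infinitesimal adjustment on $\mathfrak G$ is a continuous bilinear $\eta:\mathfrak g\times\mathfrak g\to\mathfrak h$ with $\eta([X,Y],Z)+\eta(Y,[X,Z])=\eta(X,[Y,Z])$, $\eta(t x,Y)=-\alpha(Y,x)$ and $\eta(X,t y)=\alpha(X,y)$. It is adapted to a section $s$ if $t\eta(X,Y)=[X,Y]-sp[X,Y]$. Its adjusted Kassel–Loday class $\mathrm{KL}^{\mathrm{adj}}(\mathfrak G,\eta)$ is then the unique $B\in\mathrm{Sym}^2(\mathfrak f,\mathfrak a)^{\mathrm{ad}}$ with $\tfrac12(\eta(X,Y)+\eta(Y,X))=-\iota B(pX,pY)$. A morphism $(s,\eta)\to(s',\eta')$ of adapted adjustments on $\mathfrak G$ is a continuous linear $\phi:\mathfrak f\to\mathfrak h$ with $s'-s=t\phi$ and $\eta'-\eta=\delta(p^*\phi)$. For a morphism $\mathfrak k:\mathfrak G_1\to\mathfrak G_2$ in $\mathfrak{CrMod}(\mathfrak f,\mathfrak a)$ with section $q$, and $\eta_1$ adapted to $s_1$, put $\mathrm{Adj}^q(\mathfrak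 k)(s_1,\eta_1)=(s_2,\eta_2)$ with $s_2=\phi_qs_1$ and $\eta_2=\omega_{u_2}+\iota_2p_2^*(\beta-R_q)$, where $u_1,u_2$ are half splittings extending $s_1,s_2$, $\iota_1p_1^*\beta=\eta_1-\omega_{u_1}$ and $\iota_2p_1^*R_q=\phi_q^*\omega_{u_2}-f_q\omega_{u_1}-\lambda_q$. Objects of $\mathfrak{CrMod}^{\mathrm{adj}}(\mathfrak f,\mathfrak a)$ are triples $(\mathfrak G,s,\eta)$ with $\mathfrak G$ in $\mathfrak{CrMod}(\mathfrak f,\mathfrak a)$ and $\eta$ an infinitesimal adjustment adapted to the section $s$; a morphism $(\mathfrak G_1,s_1,\eta_1)\to(\mathfrak G_2,s_2,\eta_2)$ is a triple $(\mathfrak k,q,\phi)$ of a morphism $\mathfrak k:\mathfrak G_1\to\mathfrak G_2$, a section $q$ of $\mathfrak k$, and a morphism $\phi:\mathrm{Adj}^q(\mathfrak k)(s_1,\eta_1)\to(s_2,\eta_2)$. In both cases $\pi_0$ denotes the set of objects modulo the equivalence relation generated by the existence of a morphism. **Theorem.** The assignments $[(\mathfrak G,s,\eta)]\mapsto\mathrm{KL}^{\mathrm{adj}}(\mathfrak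 G,\eta)$ and $[\mathfrak G]\mapsto\mathrm{KL}(\mathfrak G)=[C_u]$ ($u$ any half splitting) are well-defined maps $$\mathrm{KL}^{\mathrm{adj}}:\pi_0\mathfrak{CrMod}^{\mathrm{adj}}(\mathfrak f,\mathfrak a)\to\mathrm{Sym}^2(\mathfrak f,\mathfrak a)^{\mathrm{ad}},\qquad \mathrm{KL}:\pi_0\mathfrak{CrMod}(\mathfrak f,\mathfrak a)\to H^3(\mathfrak f,\mathfrak a).$$ The map $\mathrm{KL}^{\mathrm{adj}}$ is a bijection, the map $\mathrm{KL}$ is injective, and $\mathrm{cw}\circ\mathrm{KL}^{\mathrm{adj}}=\mathrm{KL}\circ\mathrm{forget}$, where $\mathrm{forget}:\pi_0\mathfrak{CrMod}^{\mathrm{adj}}(\mathfrak f,\mathfrak a)\to\pi_0\mathfrak{CrMod}(\mathfrak f,\mathfrak a)$ sends $[(\mathfrak G,s,\eta)]$ to $[\mathfrak G]$. Moreover, there is a morphism $(\mathfrak G_1,s_1,\eta_1)\to(\mathfrak G_2,s_2,\eta_2)$ in $\mathfrak{CrMod}^{\mathrm{adj}}(\mathfrak f,\mathfrak a)$ if and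 only if $\mathrm{KL}^{\mathrm{adj}}(\mathfrak G_1,\eta_1)=\mathrm{KL}^{\mathrm{adj}}(\mathfrak G_2,\eta_2)$. -/

import Mathlib

universe u

namespace AdjKL

/-! ### Locally convex Lie algebras and their continuous cohomology -/

/-- A (real, Hausdorff) locally convex Lie algebra: the vector space topology is locally convex
and Hausdorff, and the Lie bracket is jointly continuous. -/
class LCLieAlgebra (L : Type*) [LieRing L] [LieAlgebra ℝ L] [TopologicalSpace L] : Prop extends
    IsTopologicalAddGroup L, ContinuousSMul ℝ L, LocallyConvexSpace ℝ L, T2Space L where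
  continuous_bracket : Continuous fun p : L × L => ⁅p.1, p.2⁆

theorem continuous_lie {L S : Type*} [LieRing L] [LieAlgebra ℝ L] [TopologicalSpace L]
    [LCLieAlgebra L] [TopologicalSpace S] {f g : S → L} (hf : Continuous f) (hg : Continuous g) :
    Continuous fun x => ⁅f x, g x⁆ :=
  (LCLieAlgebra.continuous_bracket (L := L)).comp (hf.prodMk hg)

theorem vec3 {L : Type*} (v : Fin 3 → L) : v = ![v 0, v 1, v 2] := by
  funext i; fin_cases i <;> rfl

theorem vec4 {L : Type*} (v : Fin 4 → L) : v = ![v 0, v 1, v 2, v 3] := by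
  funext i; fin_cases i <;> rfl

/-- The Chevalley-Eilenberg differential with trivial coefficients,
`(δω)(X₀, …, X_{n+1}) = ∑_{i<j} (-1)^(i+j) ω([X_i, X_j], X₀, …, X̂_i, …, X̂_j, …, X_{n+1})`,
of an arbitrary function `ω` of `n + 1` arguments. (Numbering the arguments from `0` instead of
`1` does not change the sign.) -/
def ceDiff {L V : Type*} [LieRing L] [AddCommGroup V] {n : ℕ} (ω : (Fin (n + 1) → L) → V)
    (X : Fin (n + 2) → L) : V :=
  ∑ j : Fin (n + 2), ∑ i : Fin (n + 1),
    if i.castSucc < j then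
      (-1 : ℤ) ^ ((i : ℕ) + (j : ℕ)) •
        ω (Fin.cons ⁅X i.castSucc, X j⁆ fun k : Fin n => X (j.succAbove (i.succAbove k)))
    else 0

theorem ceDiff_one {L V : Type*} [LieRing L] [AddCommGroup V] (ω : (Fin 1 → L) → V) (X Y : L) :
    ceDiff ω ![X, Y] = -ω ![⁅X, Y⁆] := by
  have e : ∀ v w : Fin 1 → L, v 0 = w 0 → ω v = ω w := by
    intro v w h; congr 1; ext k; fin_cases k; exact h
  simp [ceDiff, Fin.sum_univ_succ]
  apply e; simp

theorem ceDiff_two {L V : Type*} [LieRing L] [AddCommGroup V] (ω : (Fin 2 → L) → V)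
    (X Y Z : L) :
    ceDiff ω ![X, Y, Z] = -ω ![⁅X, Y⁆, Z] + ω ![⁅X, Z⁆, Y] - ω ![⁅Y, Z⁆, X] := by
  have e : ∀ (a : L) (f : Fin 1 → L), (Fin.cons a f : Fin 2 → L) = ![a, f 0] := by
    intro a f; ext k; fin_cases k <;> rfl
  simp only [ceDiff, Fin.sum_univ_succ, Fin.sum_univ_zero, e]
  simp
  change -ω ![⁅X, Y⁆, Z] + (ω ![⁅X, Z⁆, Y] + -ω ![⁅Y, Z⁆, X]) = _
  abel

theorem ceDiff_three {L V : Type*} [LieRing L] [AddCommGroup V] (ω : (Fin 3 → L) → V)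
    (W X Y Z : L) :
    ceDiff ω ![W, X, Y, Z] = -ω ![⁅W, X⁆, Y, Z] + ω ![⁅W, Y⁆, X, Z] - ω ![⁅W, Z⁆, X, Y]
      - ω ![⁅X, Y⁆, W, Z] + ω ![⁅X, Z⁆, W, Y] - ω ![⁅Y, Z⁆, W, X] := by
  have e : ∀ (a : L) (f : Fin 2 → L), (Fin.cons a f : Fin 3 → L) = ![a, f 0, f 1] := by
    intro a f; ext k; fin_cases k <;> rfl
  simp only [ceDiff, Fin.sum_univ_succ, Fin.sum_univ_zero, e]
  simp
  change -ω ![⁅W, X⁆, Y, Z] + (ω ![⁅W, Y⁆, X, Z] + -ω ![⁅X, Y⁆, W, Z] +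
    (-ω ![⁅W, Z⁆, X, Y] + (ω ![⁅X, Z⁆, W, Y] + -ω ![⁅Y, Z⁆, W, X]))) = _
  abel

theorem ceDiff_add {L V : Type*} [LieRing L] [AddCommGroup V] {n : ℕ}
    (ω ω' : (Fin (n + 1) → L) → V) (X : Fin (n + 2) → L) :
    ceDiff (fun v => ω v + ω' v) X = ceDiff ω X + ceDiff ω' X := by
  simp only [ceDiff, ← Finset.sum_add_distrib]
  refine Finset.sum_congr rfl fun j _ => Finset.sum_congr rfl fun i _ => ?_
  split_ifs <;> simp

theorem ceDiff_smul {L V : Type*} [LieRing L] [AddCommGroup V] [Module ℝ V] {n : ℕ} (c : ℝ)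
    (ω : (Fin (n + 1) → L) → V) (X : Fin (n + 2) → L) :
    ceDiff (fun v => c • ω v) X = c • ceDiff ω X := by
  simp only [ceDiff, Finset.smul_sum]
  refine Finset.sum_congr rfl fun j _ => Finset.sum_congr rfl fun i _ => ?_
  split_ifs
  · rw [smul_comm]
  · simp

section Cohomology

set_option linter.unusedSectionVars false

variable (L V : Type*) [LieRing L] [LieAlgebra ℝ L] [TopologicalSpace L]
  [AddCommGroup V] [Module ℝ V] [TopologicalSpace V] [IsTopologicalAddGroup V]
  [ContinuousConstSMul ℝ V]

/-- Continuous alternating `(n + 1)`-forms `ω` with `δω = 0`. -/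
def cocycles (n : ℕ) : Submodule ℝ (L [⋀^Fin (n + 1)]→L[ℝ] V) where
  carrier := {ω | ∀ X, ceDiff ω X = 0}
  zero_mem' X := by simp [ceDiff]
  add_mem' {a b} ha hb X := by
    have h := ceDiff_add a b X
    rw [ha X, hb X, add_zero] at h
    exact h
  smul_mem' c a ha X := by
    have h := ceDiff_smul c a X
    rw [ha X, smul_zero] at h
    exact h

/-- Continuous alternating `(n + 2)`-forms of the form `δθ`, with `θ` a continuous alternating
`(n + 1)`-form. -/
def coboundaries (n : ℕ) : Submodule ℝ (L [⋀^Fin (n + 2)]→L[ℝ] V) where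
  carrier := {ω | ∃ θ : L [⋀^Fin (n + 1)]→L[ℝ] V, ∀ X, ω X = ceDiff θ X}
  zero_mem' := ⟨0, fun X => by simp [ceDiff]⟩
  add_mem' := by
    rintro a b ⟨θ, hθ⟩ ⟨θ', hθ'⟩
    refine ⟨θ + θ', fun X => ?_⟩
    have h := ceDiff_add θ θ' X
    rw [← hθ X, ← hθ' X] at h
    exact h.symm
  smul_mem' := by
    rintro c a ⟨θ, hθ⟩
    refine ⟨c • θ, fun X => ?_⟩
    have h := ceDiff_smul c θ X
    rw [← hθ X] at h
    exact h.symm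

/-- The third continuous cohomology `H³(L, V)` with trivial coefficients. -/
abbrev H3 : Type _ := cocycles L V 2 ⧸ (coboundaries L V 1).submoduleOf (cocycles L V 2)

variable {L V}

/-- A continuous alternating `3`-form from a function of three variables. -/
def alt3 (D : L → L → L → V)
    (hadd : ∀ x x' y z, D (x + x') y z = D x y z + D x' y z)
    (hsmul : ∀ (c : ℝ) x y z, D (c • x) y z = c • D x y z)
    (h12 : ∀ x y z, D y x z = -D x y z) (h23 : ∀ x y z, D x z y = -D x y z)
    (hcont : Continuous fun v : Fin 3 → L => D (v 0) (v 1) (v 2)) : L [⋀^Fin 3]→L[ℝ] V where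
  toFun v := D (v 0) (v 1) (v 2)
  map_update_add' := by
    have h2 : ∀ x y y' z, D x (y + y') z = D x y z + D x y' z := fun x y y' z => by
      rw [h12 (y + y'), hadd, h12 x y, h12 x y']; abel
    have h3 : ∀ x y z z', D x y (z + z') = D x y z + D x y z' := fun x y z z' => by
      rw [h23 x (z + z'), h2, h23 x y z, h23 x y z']; abel
    intro inst m i x y
    obtain rfl : inst = instDecidableEqFin 3 := Subsingleton.elim _ _
    fin_cases i <;> simp [hadd, h2, h3]
  map_update_smul' := by
    have h2 : ∀ (c : ℝ) x y z, D x (c • y) z = c • D x y z := fun c x y z => by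
      rw [h12 (c • y), hsmul, h12 x y, smul_neg, neg_neg]
    have h3 : ∀ (c : ℝ) x y z, D x y (c • z) = c • D x y z := fun c x y z => by
      rw [h23 x (c • z), h2, h23 x y z, smul_neg, neg_neg]
    intro inst m i c x
    obtain rfl : inst = instDecidableEqFin 3 := Subsingleton.elim _ _
    fin_cases i <;> simp [hsmul, h2, h3]
  map_eq_zero_of_eq' := by
    have e : ∀ a : V, a = -a → a = 0 := fun a ha => by
      have h : (2 : ℝ) • a = 0 := by
        rw [two_smul]
        nth_rewrite 2 [ha]
        exact add_neg_cancel a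
      exact (smul_eq_zero.1 h).resolve_left two_ne_zero
    have h0 : ∀ x z, D x x z = 0 := fun x z => e _ (h12 x x z)
    have h1 : ∀ x z, D x z z = 0 := fun x z => e _ (h23 x z z)
    have h2 : ∀ x y, D x y x = 0 := fun x y => by rw [h23, h0, neg_zero]
    intro v i j hij hne
    have key : v 0 = v 1 ∨ v 0 = v 2 ∨ v 1 = v 2 := by
      fin_cases i <;> fin_cases j
      · exact absurd rfl hne
      · exact Or.inl hij
      · exact Or.inr (Or.inl hij)
      · exact Or.inl hij.symm
      · exact absurd rfl hne
      · exact Or.inr (Or.inr hij)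
      · exact Or.inr (Or.inl hij.symm)
      · exact Or.inr (Or.inr hij.symm)
      · exact absurd rfl hne
    rcases key with h | h | h <;> rw [h]
    · exact h0 _ _
    · exact h2 _ _
    · exact h1 _ _
  cont := hcont

theorem alt3_apply (D : L → L → L → V) (hadd hsmul h12 h23 hcont) (v : Fin 3 → L) :
    alt3 D hadd hsmul h12 h23 hcont v = D (v 0) (v 1) (v 2) := rfl

end Cohomology

/-! ### Crossed modules -/

/-- A crossed module `t : 𝔥 → 𝔤`, `α : 𝔤 → Der 𝔥` of locally convex Lie algebras. -/
structure CrossedModule : Type (u + 1) where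
  𝔥 : Type u
  𝔤 : Type u
  [lieRingH : LieRing 𝔥]
  [lieAlgebraH : LieAlgebra ℝ 𝔥]
  [topologyH : TopologicalSpace 𝔥]
  [lcH : LCLieAlgebra 𝔥]
  [lieRingG : LieRing 𝔤]
  [lieAlgebraG : LieAlgebra ℝ 𝔤]
  [topologyG : TopologicalSpace 𝔤]
  [lcG : LCLieAlgebra 𝔤]
  t : 𝔥 →ₗ⁅ℝ⁆ 𝔤
  continuous_t : Continuous t
  α : 𝔤 →ₗ⁅ℝ⁆ LieDerivation ℝ 𝔥 𝔥
  continuous_α : Continuous fun v : 𝔤 × 𝔥 => α v.1 v.2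
  equivariant : ∀ X y, t (α X y) = ⁅X, t y⁆
  peiffer : ∀ x y, α (t x) y = ⁅x, y⁆

attribute [instance] CrossedModule.lieRingH CrossedModule.lieAlgebraH CrossedModule.topologyH
  CrossedModule.lcH CrossedModule.lieRingG CrossedModule.lieAlgebraG CrossedModule.topologyG
  CrossedModule.lcG

namespace CrossedModule

variable (G : CrossedModule.{u})

/-- The action is trivial on the kernel of `t`. -/
def IsCentral : Prop := ∀ X y, G.t y = 0 → G.α X y = 0

/-- A half splitting: a continuous linear map `u : 𝔤 → 𝔥` with `t u t = t`. -/
def IsHalfSplitting (u : G.𝔤 →L[ℝ] G.𝔥) : Prop := ∀ y, G.t (u (G.t y)) = G.t y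

/-- A splitting: a continuous linear map `u : 𝔤 → 𝔥` with `t u t = t` and `u t u = u`. -/
def IsSplitting (u : G.𝔤 →L[ℝ] G.𝔥) : Prop :=
  G.IsHalfSplitting u ∧ ∀ X, u (G.t (u X)) = u X

/-- Smooth separability, i.e. existence of a continuous splitting: the kernel and the image of `t`
are topologically complemented, and `t` is a topological isomorphism from a complement of its
kernel onto its image. -/
def SmoothlySeparable : Prop := ∃ u, G.IsSplitting u

/-- The `2`-form `ω_u` of a half splitting `u`, where `ρ^⊥ X = X - t (u X)`. -/
def omega (u : G.𝔤 →L[ℝ] G.𝔥) (X Y : G.𝔤) : G.𝔥 :=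
  G.α X (u Y) - G.α Y (u X) - ⁅u X, u Y⁆ + u ⁅X - G.t (u X), Y - G.t (u Y)⁆

variable {G} {u : G.𝔤 →L[ℝ] G.𝔥}

theorem omega_skew (X Y : G.𝔤) : G.omega u Y X = -G.omega u X Y := by
  unfold omega
  rw [← lie_skew (u X) (u Y), ← lie_skew (X - G.t (u X)) (Y - G.t (u Y)), map_neg]
  abel

theorem omega_add_left (X X' Y : G.𝔤) :
    G.omega u (X + X') Y = G.omega u X Y + G.omega u X' Y := by
  have e : X + X' - G.t (u (X + X')) = (X - G.t (u X)) + (X' - G.t (u X')) := by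
    rw [map_add, map_add]; abel
  unfold omega
  rw [e, map_add, map_add, add_lie, add_lie, map_add, LieDerivation.add_apply, map_add]
  abel

theorem omega_smul_left (c : ℝ) (X Y : G.𝔤) : G.omega u (c • X) Y = c • G.omega u X Y := by
  have e : c • X - G.t (u (c • X)) = c • (X - G.t (u X)) := by
    rw [map_smul, map_smul, smul_sub]
  unfold omega
  rw [e, map_smul, map_smul, smul_lie, smul_lie, map_smul, map_smul, LieDerivation.smul_apply]
  simp only [smul_add, smul_sub]

theorem continuous_omega : Continuous fun v : G.𝔤 × G.𝔤 => G.omega u v.1 v.2 := by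
  have hα : Continuous fun v : G.𝔤 × G.𝔤 => G.α v.1 (u v.2) :=
    G.continuous_α.comp (continuous_fst.prodMk (u.continuous.comp continuous_snd))
  have hα' : Continuous fun v : G.𝔤 × G.𝔤 => G.α v.2 (u v.1) :=
    G.continuous_α.comp (continuous_snd.prodMk (u.continuous.comp continuous_fst))
  have hρ : Continuous fun X : G.𝔤 => X - G.t (u X) :=
    continuous_id.sub (G.continuous_t.comp u.continuous)
  have h1 : Continuous fun v : G.𝔤 × G.𝔤 => ⁅u v.1, u v.2⁆ :=
    continuous_lie (u.continuous.comp continuous_fst) (u.continuous.comp continuous_snd)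
  have h2 : Continuous fun v : G.𝔤 × G.𝔤 => ⁅v.1 - G.t (u v.1), v.2 - G.t (u v.2)⁆ :=
    continuous_lie (hρ.comp continuous_fst) (hρ.comp continuous_snd)
  exact ((hα.sub hα').sub h1).add (u.continuous.comp h2)

theorem t_omega (hu : G.IsHalfSplitting u) (X Y : G.𝔤) :
    G.t (G.omega u X Y) = G.t (u ⁅X, Y⁆) := by
  have h1 : G.t (u ⁅X, G.t (u Y)⁆) = ⁅X, G.t (u Y)⁆ := by
    rw [← G.equivariant]; exact hu _
  have h2 : G.t (u ⁅Y, G.t (u X)⁆) = ⁅Y, G.t (u X)⁆ := by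
    rw [← G.equivariant]; exact hu _
  have h3 : G.t (u ⁅G.t (u X), G.t (u Y)⁆) = ⁅G.t (u X), G.t (u Y)⁆ := by
    rw [← LieHom.map_lie]; exact hu _
  unfold omega
  rw [map_add, map_sub, map_sub, G.equivariant, G.equivariant, LieHom.map_lie, sub_lie, lie_sub,
    lie_sub, ← lie_skew (G.t (u X)) Y]
  simp only [map_sub, map_neg, h1, h2, h3]
  abel

theorem omega_t (hc : G.IsCentral) (hu : G.IsHalfSplitting u) (X : G.𝔤) (y : G.𝔥) :
    G.omega u X (G.t y) = G.α X y := by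
  have h : G.α X (u (G.t y) - y) = 0 := hc X _ (by rw [map_sub, hu, sub_self])
  have h' : G.α (G.t (u X)) (u (G.t y) - y) = 0 := hc _ _ (by rw [map_sub, hu, sub_self])
  rw [map_sub, sub_eq_zero] at h h'
  unfold omega
  rw [hu y, sub_self, lie_zero, map_zero, add_zero, h, G.peiffer, ← G.peiffer (u X), h',
    G.peiffer, ← lie_skew y (u X)]
  abel

theorem omega_t_left (hc : G.IsCentral) (hu : G.IsHalfSplitting u) (X : G.𝔤) (y : G.𝔥) :
    G.omega u (G.t y) X = -G.α X y := by
  rw [omega_skew, omega_t hc hu]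

/-- `δω_u` vanishes after `t`. -/
theorem t_ceDiff_omega (hu : G.IsHalfSplitting u) (X Y Z : G.𝔤) :
    G.t (ceDiff (fun v => G.omega u (v 0) (v 1)) ![X, Y, Z]) = 0 := by
  rw [ceDiff_two]
  simp only [Matrix.cons_val_zero, Matrix.cons_val_one, map_add, map_sub, map_neg, t_omega hu]
  rw [← map_neg, ← map_neg, ← map_add, ← map_add, ← map_sub, ← map_sub]
  have : -⁅⁅X, Y⁆, Z⁆ + ⁅⁅X, Z⁆, Y⁆ - ⁅⁅Y, Z⁆, X⁆ = 0 := by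
    rw [← lie_skew ⁅X, Y⁆ Z, ← lie_skew ⁅Y, Z⁆ X, ← lie_skew ⁅X, Z⁆ Y,
      ← lie_skew X Z, lie_neg, neg_neg, neg_neg, sub_neg_eq_add]
    have := lie_jacobi X Y Z
    rw [← this]; abel
  rw [this, map_zero, map_zero]

/-- `δω_u` vanishes if its first argument lies in the image of `t`. -/
theorem ceDiff_omega_t (hc : G.IsCentral) (hu : G.IsHalfSplitting u) (y : G.𝔥) (X Y : G.𝔤) :
    ceDiff (fun v => G.omega u (v 0) (v 1)) ![G.t y, X, Y] = 0 := by
  rw [ceDiff_two]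
  simp only [Matrix.cons_val_zero, Matrix.cons_val_one]
  have h : ∀ Z : G.𝔤, ⁅G.t y, Z⁆ = G.t (-G.α Z y) := fun Z => by
    rw [map_neg, G.equivariant, lie_skew]
  rw [h, h, omega_t_left hc hu, omega_t_left hc hu, omega_t hc hu, LieHom.map_lie,
    LieDerivation.lie_apply, map_neg, map_neg]
  abel

theorem ceDiff_ceDiff_omega (W X Y Z : G.𝔤) :
    ceDiff (ceDiff fun v => G.omega u (v 0) (v 1)) ![W, X, Y, Z] = 0 := by
  rw [ceDiff_three]
  simp only [ceDiff_two, Matrix.cons_val_zero, Matrix.cons_val_one]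
  have hj : ∀ A B C D : G.𝔤, G.omega u ⁅⁅A, B⁆, C⁆ D =
      G.omega u ⁅⁅A, C⁆, B⁆ D - G.omega u ⁅⁅B, C⁆, A⁆ D := fun A B C D => by
    rw [sub_eq_add_neg, ← neg_one_smul ℝ (G.omega u ⁅⁅B, C⁆, A⁆ D), ← omega_smul_left,
      ← omega_add_left]
    congr 1
    rw [neg_one_smul, lie_skew, lie_lie, ← lie_skew ⁅A, C⁆ B]
    abel
  rw [hj W X Y Z, hj W X Z Y, hj W Y Z X, hj X Y Z W,
    omega_skew ⁅W, X⁆ ⁅Y, Z⁆, omega_skew ⁅W, Y⁆ ⁅X, Z⁆, omega_skew ⁅W, Z⁆ ⁅X, Y⁆]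
  abel

end CrossedModule

section FixedHomotopy

set_option linter.unusedSectionVars false

variable (𝔣 𝔞 : Type u) [LieRing 𝔣] [LieAlgebra ℝ 𝔣] [TopologicalSpace 𝔣] [LCLieAlgebra 𝔣]
  [LieRing 𝔞] [LieAlgebra ℝ 𝔞] [TopologicalSpace 𝔞] [LCLieAlgebra 𝔞]

/-- A central, smoothly separable crossed module with fixed identifications `π₀ ≅ 𝔣` and
`π₁ ≅ 𝔞`, given by the outer maps of the exact sequence `0 → 𝔞 → 𝔥 → 𝔤 → 𝔣 → 0`. -/
structure CrMod : Type (u + 1) extends CrossedModule.{u} where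
  central : toCrossedModule.IsCentral
  separable : toCrossedModule.SmoothlySeparable
  ι : 𝔞 →ₗ⁅ℝ⁆ 𝔥
  isEmbedding_ι : Topology.IsEmbedding ι
  range_ι : ∀ y, (∃ a, ι a = y) ↔ t y = 0
  p : 𝔤 →ₗ⁅ℝ⁆ 𝔣
  isQuotientMap_p : Topology.IsQuotientMap p
  ker_p : ∀ X, p X = 0 ↔ ∃ y, t y = X

variable {𝔣 𝔞}

namespace CrMod

variable (G : CrMod 𝔣 𝔞)

/-- A section: a continuous linear map `s : 𝔣 → 𝔤` with `p s = id`. -/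
def IsSection (s : 𝔣 →L[ℝ] G.𝔤) : Prop := ∀ x, G.p (s x) = x

variable {G}

theorem ι_mem (a : 𝔞) : G.t (G.ι a) = 0 := (G.range_ι _).1 ⟨a, rfl⟩

theorem p_t (y : G.𝔥) : G.p (G.t y) = 0 := (G.ker_p _).2 ⟨y, rfl⟩

/-- The section determined by a half splitting. -/
theorem exists_section {u : G.𝔤 →L[ℝ] G.𝔥} (hu : G.IsHalfSplitting u) :
    ∃ s : 𝔣 →L[ℝ] G.𝔤, G.IsSection s ∧ ∀ X, s (G.p X) = X - G.t (u X) := by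
  have hp := G.isQuotientMap_p.surjective
  let g : G.𝔤 →ₗ[ℝ] G.𝔤 := LinearMap.id - G.t.toLinearMap ∘ₗ u.toLinearMap
  have hg : ∀ X, g X = X - G.t (u X) := fun X => rfl
  have key : ∀ X Y, G.p X = G.p Y → g X = g Y := fun X Y h => by
    obtain ⟨y, hy⟩ := (G.ker_p (X - Y)).1 (by rw [map_sub, h, sub_self])
    have : g (X - Y) = 0 := by rw [hg, ← hy, hu, sub_self]
    rwa [map_sub, sub_eq_zero] at this
  have hs : ∀ X, g (Function.surjInv hp (G.p X)) = g X := fun X =>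
    key _ _ (Function.surjInv_eq hp _)
  let s : 𝔣 →ₗ[ℝ] G.𝔤 :=
    { toFun := fun x => g (Function.surjInv hp x)
      map_add' := fun x y => by
        obtain ⟨X, rfl⟩ := hp x
        obtain ⟨Y, rfl⟩ := hp y
        rw [← map_add, hs, hs, hs, map_add]
      map_smul' := fun c x => by
        obtain ⟨X, rfl⟩ := hp x
        rw [← map_smul, hs, hs, map_smul]
        rfl }
  have hsp : ∀ X, s (G.p X) = X - G.t (u X) := hs
  have hc : Continuous s := by
    rw [G.isQuotientMap_p.continuous_iff]
    have e : s ∘ G.p = fun X => X - G.t (u X) := funext hsp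
    rw [e]
    exact continuous_id.sub (G.continuous_t.comp u.continuous)
  refine ⟨⟨s, hc⟩, fun x => ?_, hsp⟩
  obtain ⟨X, rfl⟩ := hp x
  change G.p (s (G.p X)) = G.p X
  rw [hsp, map_sub, p_t, sub_zero]

/-- `δω_u` descends to a unique `𝔞`-valued cocycle on `𝔣`. -/
theorem existsUnique_klCocycle {u : G.𝔤 →L[ℝ] G.𝔥} (hu : G.IsHalfSplitting u) :
    ∃! C : cocycles 𝔣 𝔞 2, ∀ X Y Z,
      G.ι (C.1 ![G.p X, G.p Y, G.p Z]) = ceDiff (fun v => G.omega u (v 0) (v 1)) ![X, Y, Z] := by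
  obtain ⟨s, hs, hsp⟩ := exists_section hu
  have hp := G.isQuotientMap_p.surjective
  have hι := G.isEmbedding_ι.injective
  obtain ⟨E, hE0⟩ : ∃ E : G.𝔤 → G.𝔤 → G.𝔤 → G.𝔥, ∀ X Y Z,
      ceDiff (fun v => G.omega u (v 0) (v 1)) ![X, Y, Z] = E X Y Z := ⟨_, fun _ _ _ => rfl⟩
  have hE : ∀ X Y Z, E X Y Z =
      -G.omega u ⁅X, Y⁆ Z + G.omega u ⁅X, Z⁆ Y - G.omega u ⁅Y, Z⁆ X := fun X Y Z => by
    simp only [← hE0, ceDiff_two, Matrix.cons_val_zero, Matrix.cons_val_one]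
  have ω0 : ∀ X Y : G.𝔤, G.omega u (-X) Y = -G.omega u X Y := fun X Y => by
    rw [← neg_one_smul ℝ X, CrossedModule.omega_smul_left, neg_one_smul]
  have ωr : ∀ X Y Z : G.𝔤, G.omega u X (Y + Z) = G.omega u X Y + G.omega u X Z := fun X Y Z => by
    rw [CrossedModule.omega_skew (Y + Z) X, CrossedModule.omega_skew Y X,
      CrossedModule.omega_skew Z X, CrossedModule.omega_add_left]; abel
  have ωs : ∀ (c : ℝ) (X Y : G.𝔤), G.omega u X (c • Y) = c • G.omega u X Y := fun c X Y => by
    rw [CrossedModule.omega_skew (c • Y) X, CrossedModule.omega_skew Y X,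
      CrossedModule.omega_smul_left, smul_neg]
  have E12 : ∀ X Y Z, E Y X Z = -E X Y Z := fun X Y Z => by
    rw [hE, hE, ← lie_skew Y X, ω0]; abel
  have E23 : ∀ X Y Z, E X Z Y = -E X Y Z := fun X Y Z => by
    rw [hE, hE, ← lie_skew Z Y, ω0]; abel
  have Eadd : ∀ X X' Y Z, E (X + X') Y Z = E X Y Z + E X' Y Z := fun X X' Y Z => by
    rw [hE, hE, hE, add_lie, add_lie, CrossedModule.omega_add_left, CrossedModule.omega_add_left,
      ωr]
    abel
  have Esmul : ∀ (c : ℝ) X Y Z, E (c • X) Y Z = c • E X Y Z := fun c X Y Z => by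
    rw [hE, hE, smul_lie, smul_lie, CrossedModule.omega_smul_left, CrossedModule.omega_smul_left,
      ωs, smul_sub, smul_add, smul_neg]
  have Ec : Continuous fun v : Fin 3 → G.𝔤 => E (v 0) (v 1) (v 2) := by
    have hb : ∀ i j k : Fin 3, Continuous fun v : Fin 3 → G.𝔤 => G.omega u ⁅v i, v j⁆ (v k) :=
      fun i j k => by
        have hb' : Continuous fun v : Fin 3 → G.𝔤 => ⁅v i, v j⁆ :=
          continuous_lie (continuous_apply i) (continuous_apply j)
        exact (CrossedModule.continuous_omega (u := u)).comp (hb'.prodMk (continuous_apply k))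
    simp only [hE]
    exact ((hb 0 1 2).neg.add (hb 0 2 1)).sub (hb 1 2 0)
  have Ep : ∀ X Y Z, E (s (G.p X)) Y Z = E X Y Z := fun X Y Z => by
    rw [hsp, sub_eq_add_neg, Eadd, ← map_neg]
    rw [← hE0 (G.t (-u X)), CrossedModule.ceDiff_omega_t G.central hu, add_zero]
  have Ep3 : ∀ X Y Z, E (s (G.p X)) (s (G.p Y)) (s (G.p Z)) = E X Y Z := fun X Y Z => by
    rw [Ep, ← neg_neg (E X _ _), ← E12, Ep, E12, neg_neg, ← neg_neg (E X _ _), ← E23, ← neg_neg (E X _ _), ← E12, Ep, E12, neg_neg, E23, neg_neg]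
  have hD : ∀ x y z, ∃ a, G.ι a = E (s x) (s y) (s z) := fun x y z =>
    (G.range_ι _).2 (by rw [← hE0]; exact CrossedModule.t_ceDiff_omega hu _ _ _)
  choose D hD using hD
  have hDp : ∀ X Y Z, G.ι (D (G.p X) (G.p Y) (G.p Z)) = E X Y Z := fun X Y Z => by rw [hD, Ep3]
  let C : 𝔣 [⋀^Fin 3]→L[ℝ] 𝔞 := alt3 D
    (fun x x' y z => hι <| by rw [map_add, hD, hD, hD, map_add, Eadd])
    (fun c x y z => hι <| by rw [map_smul, hD, hD, map_smul, Esmul])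
    (fun x y z => hι <| by rw [map_neg, hD, hD, E12])
    (fun x y z => hι <| by rw [map_neg, hD, hD, E23])
    (by
      rw [G.isEmbedding_ι.continuous_iff]
      have e : G.ι ∘ (fun v : Fin 3 → 𝔣 => D (v 0) (v 1) (v 2)) =
          fun v => E (s (v 0)) (s (v 1)) (s (v 2)) := funext fun v => hD _ _ _
      rw [e]
      exact Ec.comp (continuous_pi fun i => s.continuous.comp (continuous_apply i)))
  have hC : ∀ x y z, C ![x, y, z] = D x y z := fun x y z => rfl
  have hcl : ∀ v : Fin 4 → 𝔣, ceDiff C v = 0 := fun v => by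
    obtain ⟨W, hW⟩ := hp (v 0)
    obtain ⟨X, hX⟩ := hp (v 1)
    obtain ⟨Y, hY⟩ := hp (v 2)
    obtain ⟨Z, hZ⟩ := hp (v 3)
    have hv : v = ![G.p W, G.p X, G.p Y, G.p Z] := by rw [hW, hX, hY, hZ]; exact vec4 v
    apply hι
    rw [hv, ceDiff_three]
    simp only [hC, ← LieHom.map_lie, map_add, map_sub, map_neg, hDp, map_zero]
    have h := CrossedModule.ceDiff_ceDiff_omega (u := u) W X Y Z
    rw [ceDiff_three] at h
    simpa only [hE0] using h
  refine ⟨⟨C, hcl⟩, fun X Y Z => (hDp X Y Z).trans (hE0 X Y Z).symm, fun C' hC' => ?_⟩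
  apply Subtype.ext
  ext v
  obtain ⟨X, hX⟩ := hp (v 0)
  obtain ⟨Y, hY⟩ := hp (v 1)
  obtain ⟨Z, hZ⟩ := hp (v 2)
  have hv : v = ![G.p X, G.p Y, G.p Z] := by rw [hX, hY, hZ]; exact vec3 v
  apply hι
  rw [hv, hC' X Y Z, hE0]
  exact (hDp X Y Z).symm

variable (G)

/-- The cocycle `C_u` with `p^* C_u = δω_u`. -/
noncomputable def klCocycle (u : G.𝔤 →L[ℝ] G.𝔥) (hu : G.IsHalfSplitting u) : cocycles 𝔣 𝔞 2 :=
  (existsUnique_klCocycle hu).choose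

theorem klCocycle_spec (u : G.𝔤 →L[ℝ] G.𝔥) (hu : G.IsHalfSplitting u) (X Y Z : G.𝔤) :
    G.ι ((G.klCocycle u hu).1 ![G.p X, G.p Y, G.p Z]) =
      ceDiff (fun v => G.omega u (v 0) (v 1)) ![X, Y, Z] :=
  (existsUnique_klCocycle hu).choose_spec.1 X Y Z

/-- The class of `C_u` in the third cohomology. -/
noncomputable def klClass (u : G.𝔤 →L[ℝ] G.𝔥) (hu : G.IsHalfSplitting u) : H3 𝔣 𝔞 :=
  Submodule.Quotient.mk (G.klCocycle u hu)

end CrMod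

/-! ### Invariant symmetric bilinear forms and the Chern-Weil homomorphism -/

variable (𝔣 𝔞)

/-- Continuous symmetric `ad`-invariant bilinear forms on `𝔣` with values in `𝔞`. -/
def Sym2Ad : Submodule ℝ (𝔣 →ₗ[ℝ] 𝔣 →ₗ[ℝ] 𝔞) where
  carrier := {B | (Continuous fun v : 𝔣 × 𝔣 => B v.1 v.2) ∧ (∀ x y, B x y = B y x) ∧
    ∀ x y z : 𝔣, B ⁅x, y⁆ z + B y ⁅x, z⁆ = 0}
  zero_mem' := by simp [continuous_const]
  add_mem' := by
    rintro a b ⟨ha, ha', ha''⟩ ⟨hb, hb', hb''⟩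
    refine ⟨ha.add hb, fun x y => ?_, fun x y z => ?_⟩
    · rw [LinearMap.add_apply, LinearMap.add_apply, LinearMap.add_apply, LinearMap.add_apply,
        ha', hb']
    · simp only [LinearMap.add_apply]
      rw [add_add_add_comm, ha'', hb'', add_zero]
  smul_mem' := by
    rintro c a ⟨ha, ha', ha''⟩
    refine ⟨ha.const_smul c, fun x y => ?_, fun x y z => ?_⟩
    · rw [LinearMap.smul_apply, LinearMap.smul_apply, LinearMap.smul_apply, LinearMap.smul_apply,
        ha']
    · simp only [LinearMap.smul_apply]
      rw [← smul_add, ha'', smul_zero]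

variable {𝔣 𝔞}

theorem Sym2Ad.continuous (B : Sym2Ad 𝔣 𝔞) : Continuous fun v : 𝔣 × 𝔣 => B.1 v.1 v.2 :=
  ((show B.1 ∈ Sym2Ad 𝔣 𝔞 from B.2) : _ ∧ _).1

theorem Sym2Ad.symm (B : Sym2Ad 𝔣 𝔞) (x y : 𝔣) : B.1 x y = B.1 y x :=
  ((show B.1 ∈ Sym2Ad 𝔣 𝔞 from B.2) : _ ∧ _ ∧ _).2.1 x y

theorem Sym2Ad.invariant (B : Sym2Ad 𝔣 𝔞) (x y z : 𝔣) : B.1 ⁅x, y⁆ z = B.1 x ⁅y, z⁆ := by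
  have h := ((show B.1 ∈ Sym2Ad 𝔣 𝔞 from B.2) : _ ∧ _ ∧ _).2.2 y x z
  rw [← lie_skew, map_neg, LinearMap.neg_apply, eq_comm]
  exact eq_neg_of_add_eq_zero_right h

/-- The Chern-Weil `3`-cocycle `(x, y, z) ↦ B([x, y], z)`. -/
def cwCocycle (B : Sym2Ad 𝔣 𝔞) : cocycles 𝔣 𝔞 2 :=
  ⟨alt3 (fun x y z => B.1 ⁅x, y⁆ z)
    (fun x x' y z => by rw [add_lie, map_add, LinearMap.add_apply])
    (fun c x y z => by rw [smul_lie, map_smul, LinearMap.smul_apply])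
    (fun x y z => by rw [← lie_skew, map_neg, LinearMap.neg_apply])
    (fun x y z => by
      rw [Sym2Ad.invariant B, Sym2Ad.invariant B, ← lie_skew, map_neg])
    (by
      have h : Continuous fun v : Fin 3 → 𝔣 => ((⁅v 0, v 1⁆, v 2) : 𝔣 × 𝔣) :=
        (continuous_lie (continuous_apply 0) (continuous_apply 1)).prodMk (continuous_apply 2)
      exact (Sym2Ad.continuous B).comp h),
  fun v => by
    rw [vec4 v, ceDiff_three]
    generalize v 0 = w, v 1 = x, v 2 = y, v 3 = z
    change -B.1 ⁅⁅w, x⁆, y⁆ z + B.1 ⁅⁅w, y⁆, x⁆ z - B.1 ⁅⁅w, z⁆, x⁆ y - B.1 ⁅⁅x, y⁆, w⁆ z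
      + B.1 ⁅⁅x, z⁆, w⁆ y - B.1 ⁅⁅y, z⁆, w⁆ x = 0
    have h1 : B.1 ⁅⁅y, z⁆, w⁆ x = B.1 ⁅z, ⁅w, x⁆⁆ y := by
      rw [Sym2Ad.invariant B, Sym2Ad.invariant B, Sym2Ad.symm B]
    have h2 : ⁅⁅w, y⁆, x⁆ = ⁅⁅w, x⁆, y⁆ + ⁅⁅x, y⁆, w⁆ := by
      rw [lie_lie w x y, ← lie_skew ⁅x, y⁆ w, ← lie_skew ⁅w, y⁆ x]; abel
    have h3 : ⁅⁅w, z⁆, x⁆ = ⁅⁅x, z⁆, w⁆ - ⁅z, ⁅w, x⁆⁆ := by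
      rw [← lie_skew z ⁅w, x⁆, lie_lie w x z, ← lie_skew ⁅x, z⁆ w, ← lie_skew ⁅w, z⁆ x]; abel
    rw [h1, h2, h3, map_add, map_sub, LinearMap.add_apply, LinearMap.sub_apply]
    abel⟩

/-- The Chern-Weil homomorphism. -/
def cw : Sym2Ad 𝔣 𝔞 →ₗ[ℝ] H3 𝔣 𝔞 :=
  ((coboundaries 𝔣 𝔞 1).submoduleOf (cocycles 𝔣 𝔞 2)).mkQ ∘ₗ
    { toFun := cwCocycle
      map_add' := fun B B' => by apply Subtype.ext; ext v; rfl
      map_smul' := fun c B => by apply Subtype.ext; ext v; rfl }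

/-! ### Infinitesimal adjustments -/

/-- An infinitesimal adjustment on a crossed module. -/
structure InfAdjustment (G : CrossedModule.{u}) where
  η : G.𝔤 →ₗ[ℝ] G.𝔤 →ₗ[ℝ] G.𝔥
  continuous_η : Continuous fun v : G.𝔤 × G.𝔤 => η v.1 v.2
  η_lie : ∀ X Y Z : G.𝔤, η ⁅X, Y⁆ Z + η Y ⁅X, Z⁆ = η X ⁅Y, Z⁆
  η_t_left : ∀ x Y, η (G.t x) Y = -G.α Y x
  η_t_right : ∀ X y, η X (G.t y) = G.α X y

/-- An object of the groupoid of infinitesimal adjustments on `G`: a section `s` and an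
infinitesimal adjustment `η` adapted to `s`, i.e. `t η(X, Y) = ρ_s [X, Y]` with
`ρ_s = id - s p`. -/
structure AdaptedAdjustment (G : CrMod 𝔣 𝔞) extends InfAdjustment G.toCrossedModule where
  s : 𝔣 →L[ℝ] G.𝔤
  isSection : G.IsSection s
  adapted : ∀ X Y, G.t (η X Y) = ⁅X, Y⁆ - s (G.p ⁅X, Y⁆)

/-- Morphisms `(s, η) → (s', η')` in the groupoid of infinitesimal adjustments on `G`: continuous
linear maps `φ : 𝔣 → 𝔥` with `s' - s = t φ` and `η' - η = δ(p^* φ)`. -/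
structure AdaptedAdjustment.Hom {G : CrMod 𝔣 𝔞} (a b : AdaptedAdjustment G) where
  φ : 𝔣 →L[ℝ] G.𝔥
  section_eq : ∀ x, b.s x - a.s x = G.t (φ x)
  η_eq : ∀ X Y, b.η X Y - a.η X Y = ceDiff (fun v : Fin 1 → G.𝔤 => φ (G.p (v 0))) ![X, Y]

/-- The symmetric part of an adapted adjustment is `-p^* B` for a unique invariant symmetric
bilinear form `B`. -/
theorem existsUnique_adjustedKL {G : CrMod 𝔣 𝔞} (a : AdaptedAdjustment G) :
    ∃! B : Sym2Ad 𝔣 𝔞, ∀ X Y,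
      (1 / 2 : ℝ) • (a.η X Y + a.η Y X) = -G.ι (B.1 (G.p X) (G.p Y)) := by
  have hp := G.isQuotientMap_p.surjective
  have hι := G.isEmbedding_ι.injective
  obtain ⟨S, hS⟩ : ∃ S : G.𝔤 → G.𝔤 → G.𝔥, ∀ X Y,
      -((1 / 2 : ℝ) • (a.η X Y + a.η Y X)) = S X Y := ⟨_, fun _ _ => rfl⟩
  have Ssymm : ∀ X Y, S X Y = S Y X := fun X Y => by rw [← hS, ← hS, add_comm]
  have Sadd : ∀ X X' Y, S (X + X') Y = S X Y + S X' Y := fun X X' Y => by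
    simp only [← hS, map_add, LinearMap.add_apply, smul_add]
    abel
  have Ssmul : ∀ (c : ℝ) X Y, S (c • X) Y = c • S X Y := fun c X Y => by
    simp only [← hS, map_smul, LinearMap.smul_apply, smul_add, smul_neg, smul_comm c]
  have St : ∀ x Y, S (G.t x) Y = 0 := fun x Y => by
    rw [← hS, a.η_t_left, a.η_t_right, neg_add_cancel, smul_zero, neg_zero]
  have tS : ∀ X Y, G.t (S X Y) = 0 := fun X Y => by
    rw [← hS, map_neg, map_smul, map_add, a.adapted, a.adapted, ← lie_skew X Y]
    simp only [map_neg]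
    rw [← neg_sub', neg_add_cancel, smul_zero, neg_zero]
  have Slie : ∀ X Y Z : G.𝔤, S ⁅X, Y⁆ Z + S Y ⁅X, Z⁆ = 0 := fun X Y Z => by
    have h1 := a.η_lie X Y Z
    have h2 := a.η_lie X Z Y
    rw [← lie_skew Y Z, map_neg] at h1
    have h3 : a.η ⁅X, Y⁆ Z + a.η Z ⁅X, Y⁆ + (a.η Y ⁅X, Z⁆ + a.η ⁅X, Z⁆ Y) = 0 := by
      have := congrArg₂ (· + ·) h1 h2
      simp only [neg_add_cancel] at this
      rw [← this]; abel
    rw [← hS, ← hS, ← neg_add, ← smul_add, h3, smul_zero, neg_zero]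
  have Sc : Continuous fun v : G.𝔤 × G.𝔤 => S v.1 v.2 := by
    simp only [← hS]
    exact ((a.continuous_η.add (a.continuous_η.comp continuous_swap)).const_smul _).neg
  have hsp : ∀ X Y, S (a.s (G.p X)) Y = S X Y := fun X Y => by
    obtain ⟨y, hy⟩ := (G.ker_p (X - a.s (G.p X))).1 (by rw [map_sub, a.isSection, sub_self])
    rw [eq_sub_iff_add_eq] at hy
    conv_rhs => rw [← hy, Sadd, St, zero_add]
  have hB : ∀ x y, ∃ b, G.ι b = S (a.s x) (a.s y) := fun x y => (G.range_ι _).2 (tS _ _)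
  choose B hB using hB
  have hBp : ∀ X Y, G.ι (B (G.p X) (G.p Y)) = S X Y := fun X Y => by
    rw [hB, hsp, Ssymm, hsp, Ssymm]
  have Bsymm : ∀ x y, B x y = B y x := fun x y => hι <| by rw [hB, hB, Ssymm]
  have Badd : ∀ x x' y, B (x + x') y = B x y + B x' y := fun x x' y => hι <| by
    rw [map_add, hB, hB, hB, map_add, Sadd]
  have Bsmul : ∀ (c : ℝ) x y, B (c • x) y = c • B x y := fun c x y => hι <| by
    rw [map_smul, hB, hB, map_smul, Ssmul]
  let B' : 𝔣 →ₗ[ℝ] 𝔣 →ₗ[ℝ] 𝔞 := LinearMap.mk₂ ℝ B Badd Bsmul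
    (fun x y y' => by rw [Bsymm, Badd, Bsymm y, Bsymm y'])
    (fun c x y => by rw [Bsymm, Bsmul, Bsymm y])
  have hB' : B' ∈ Sym2Ad 𝔣 𝔞 := by
    refine ⟨?_, fun x y => Bsymm x y, fun x y z => ?_⟩
    · change Continuous fun v : 𝔣 × 𝔣 => B v.1 v.2
      rw [G.isEmbedding_ι.continuous_iff]
      have e : G.ι ∘ (fun v : 𝔣 × 𝔣 => B v.1 v.2) = fun v => S (a.s v.1) (a.s v.2) :=
        funext fun v => hB _ _
      rw [e]
      exact Sc.comp ((a.s.continuous.comp continuous_fst).prodMk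
        (a.s.continuous.comp continuous_snd))
    · change B ⁅x, y⁆ z + B y ⁅x, z⁆ = 0
      obtain ⟨X, rfl⟩ := hp x
      obtain ⟨Y, rfl⟩ := hp y
      obtain ⟨Z, rfl⟩ := hp z
      apply hι
      rw [← LieHom.map_lie, ← LieHom.map_lie, map_add, hBp, hBp, Slie, map_zero]
  refine ⟨⟨B', hB'⟩, fun X Y => ?_, fun C hC => ?_⟩
  · change _ = -G.ι (B (G.p X) (G.p Y))
    rw [hBp, ← hS, neg_neg]
  · apply Subtype.ext
    ext x y
    obtain ⟨X, rfl⟩ := hp x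
    obtain ⟨Y, rfl⟩ := hp y
    apply hι
    change _ = G.ι (B (G.p X) (G.p Y))
    rw [hBp, ← hS, hC, neg_neg]

/-- The adjusted Kassel-Loday class: the form `B` with `η^s = -p^* B`. -/
noncomputable def AdaptedAdjustment.adjustedKL {G : CrMod 𝔣 𝔞} (a : AdaptedAdjustment G) :
    Sym2Ad 𝔣 𝔞 :=
  (existsUnique_adjustedKL a).choose

theorem AdaptedAdjustment.adjustedKL_spec {G : CrMod 𝔣 𝔞} (a : AdaptedAdjustment G)
    (X Y : G.𝔤) :
    (1 / 2 : ℝ) • (a.η X Y + a.η Y X) = -G.ι (a.adjustedKL.1 (G.p X) (G.p Y)) :=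
  (existsUnique_adjustedKL a).choose_spec.1 X Y

end FixedHomotopy

/-! ### Butterflies -/

/-- A topologically split short exact sequence `0 → A → K → B → 0`. -/
def SplitExact {A K B : Type u} [AddCommGroup A] [Module ℝ A] [TopologicalSpace A]
    [AddCommGroup K] [Module ℝ K] [TopologicalSpace K]
    [AddCommGroup B] [Module ℝ B] [TopologicalSpace B] (i : A →ₗ[ℝ] K) (r : K →ₗ[ℝ] B) : Prop :=
  (∀ a, r (i a) = 0) ∧ ∃ (q : B →L[ℝ] K) (j : K →L[ℝ] A),
    (∀ b, r (q b) = b) ∧ (∀ a, j (i a) = a) ∧ ∀ X, i (j X) + q (r X) = X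

/-- A butterfly `G₁ → G₂`. -/
structure Butterfly (G₁ G₂ : CrossedModule.{u}) : Type (u + 1) where
  𝔨 : Type u
  [lieRingK : LieRing 𝔨]
  [lieAlgebraK : LieAlgebra ℝ 𝔨]
  [topologyK : TopologicalSpace 𝔨]
  [lcK : LCLieAlgebra 𝔨]
  i₁ : G₁.𝔥 →ₗ⁅ℝ⁆ 𝔨
  i₂ : G₂.𝔥 →ₗ⁅ℝ⁆ 𝔨
  r₁ : 𝔨 →ₗ⁅ℝ⁆ G₁.𝔤
  r₂ : 𝔨 →ₗ⁅ℝ⁆ G₂.𝔤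
  continuous_i₁ : Continuous i₁
  continuous_i₂ : Continuous i₂
  continuous_r₁ : Continuous r₁
  continuous_r₂ : Continuous r₂
  r₁_i₁ : ∀ y, r₁ (i₁ y) = G₁.t y
  r₂_i₂ : ∀ y, r₂ (i₂ y) = G₂.t y
  r₂_i₁ : ∀ y, r₂ (i₁ y) = 0
  exact : SplitExact i₂.toLinearMap r₁.toLinearMap
  i₁_α : ∀ X y, i₁ (G₁.α (r₁ X) y) = ⁅X, i₁ y⁆
  i₂_α : ∀ X y, i₂ (G₂.α (r₂ X) y) = ⁅X, i₂ y⁆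

attribute [instance] Butterfly.lieRingK Butterfly.lieAlgebraK Butterfly.topologyK Butterfly.lcK

namespace Butterfly

variable {G₁ G₂ : CrossedModule.{u}}

/-- A butterfly is invertible if its other diagonal is exact, too. -/
def Invertible (k : Butterfly G₁ G₂) : Prop :=
  SplitExact k.i₁.toLinearMap k.r₂.toLinearMap

/-- A section `q` of a butterfly, together with the map `j` that it determines by
`i₂ j + q r₁ = id`. -/
structure Sec (k : Butterfly G₁ G₂) where
  q : G₁.𝔤 →L[ℝ] k.𝔨
  j : k.𝔨 →L[ℝ] G₂.𝔥
  r₁_q : ∀ X, k.r₁ (q X) = X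
  i₂_j : ∀ Z, k.i₂ (j Z) + q (k.r₁ Z) = Z

namespace Sec

variable {k : Butterfly G₁ G₂} (σ : k.Sec)

/-- `φ_q = r₂ q`. -/
def φ (X : G₁.𝔤) : G₂.𝔤 := k.r₂ (σ.q X)

/-- `f_q = -j i₁`. -/
def f (y : G₁.𝔥) : G₂.𝔥 := -σ.j (k.i₁ y)

/-- `λ_q(X, Y) = j [q X, q Y]`. -/
def lam (X Y : G₁.𝔤) : G₂.𝔥 := σ.j ⁅σ.q X, σ.q Y⁆

end Sec

end Butterfly

section Classification

variable {𝔣 𝔞 : Type u} [LieRing 𝔣] [LieAlgebra ℝ 𝔣] [TopologicalSpace 𝔣] [LCLieAlgebra 𝔣]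
  [LieRing 𝔞] [LieAlgebra ℝ 𝔞] [TopologicalSpace 𝔞] [LCLieAlgebra 𝔞]

/-- `1`-morphisms of crossed modules with fixed `π₀` and `π₁`: invertible butterflies inducing the
identities on `π₀ = 𝔣` and `π₁ = 𝔞`. -/
structure CrMod.Mor (G₁ G₂ : CrMod 𝔣 𝔞) : Type (u + 1) extends
    Butterfly G₁.toCrossedModule G₂.toCrossedModule where
  invertible : toButterfly.Invertible
  π₀_eq : ∀ X, G₂.p (r₂ X) = G₁.p (r₁ X)
  π₁_eq : ∀ a, i₂ (G₂.ι a) = -i₁ (G₁.ι a)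

/-- The relation `b = Adj^q(k)(a)` between adapted adjustments `a = (s₁, η₁)` on `G₁` and
`b = (s₂, η₂)` on `G₂`: `s₂ = φ_q s₁`, and for half splittings `u₁`, `u₂` extending `s₁`, `s₂`
one has `η₂ = ω_{u₂} + p₂^*(β - R_q)`, where `p₁^* β = η₁ - ω_{u₁}` and
`p₁^* R_q = φ_q^* ω_{u₂} - f_q ω_{u₁} - λ_q`. -/
def CrMod.Mor.IsTransport {G₁ G₂ : CrMod 𝔣 𝔞} (k : CrMod.Mor G₁ G₂) (σ : k.toButterfly.Sec)
    (a : AdaptedAdjustment G₁) (b : AdaptedAdjustment G₂) : Prop :=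
  (∀ x, b.s x = σ.φ (a.s x)) ∧
  ∃ (u₁ : G₁.𝔤 →L[ℝ] G₁.𝔥) (u₂ : G₂.𝔤 →L[ℝ] G₂.𝔥) (β R : 𝔣 → 𝔣 → 𝔞),
    (∀ X, G₁.t (u₁ X) = X - a.s (G₁.p X)) ∧
    (∀ X, G₂.t (u₂ X) = X - b.s (G₂.p X)) ∧
    (∀ X Y, G₁.ι (β (G₁.p X) (G₁.p Y)) = a.η X Y - G₁.omega u₁ X Y) ∧
    (∀ X Y, G₂.ι (R (G₁.p X) (G₁.p Y)) =
      G₂.omega u₂ (σ.φ X) (σ.φ Y) - σ.f (G₁.omega u₁ X Y) - σ.lam X Y) ∧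
    ∀ X Y, b.η X Y = G₂.omega u₂ X Y +
      G₂.ι (β (G₂.p X) (G₂.p Y) - R (G₂.p X) (G₂.p Y))

variable (𝔣 𝔞)

/-- Adjusted crossed modules `(G, s, η)` with `π₀ = 𝔣` and `π₁ = 𝔞`. -/
structure AdjCrMod : Type (u + 1) where
  G : CrMod 𝔣 𝔞
  adj : AdaptedAdjustment G

variable {𝔣 𝔞}

/-- `1`-morphisms `(G₁, s₁, η₁) → (G₂, s₂, η₂)` of adjusted crossed modules: an invertible butterfly
`k`, a section `q` of `k`, and a morphism `Adj^q(k)(s₁, η₁) → (s₂, η₂)` of adapted adjustments on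
`G₂`. -/
structure AdjCrMod.Mor (X₁ X₂ : AdjCrMod 𝔣 𝔞) : Type (u + 1) where
  k : CrMod.Mor X₁.G X₂.G
  q : k.toButterfly.Sec
  transported : AdaptedAdjustment X₂.G
  isTransport : k.IsTransport q X₁.adj transported
  φ : AdaptedAdjustment.Hom transported X₂.adj

variable (𝔣 𝔞)

/-- Isomorphism classes of crossed modules with fixed `π₀` and `π₁`. -/
def CrMod.Pi0 : Type (u + 1) := Quot fun G₁ G₂ : CrMod 𝔣 𝔞 => Nonempty (CrMod.Mor G₁ G₂)

/-- Isomorphism classes of adjusted crossed modules with fixed `π₀` and `π₁`. -/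
def AdjCrMod.Pi0 : Type (u + 1) := Quot fun X₁ X₂ : AdjCrMod 𝔣 𝔞 => Nonempty (AdjCrMod.Mor X₁ X₂)

/-- The map on isomorphism classes that forgets the section and the adjustment. -/
def AdjCrMod.forget : AdjCrMod.Pi0 𝔣 𝔞 → CrMod.Pi0 𝔣 𝔞 :=
  Quot.map AdjCrMod.G fun _ _ ⟨m⟩ => ⟨m.k⟩

end Classification

end AdjKL

namespace AdjKL

/-! ### Constructions of locally convex Lie algebras -/

section Constructions

/-! Everything rests on comparing `𝔥`-valued forms with the same behaviour along `t`. If `u` extends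
a section `s`, then `ω_u` equals the action, up to sign, as soon as one argument is in the image of
`t`, and `t ω_u(X, Y) = [X, Y] - s p [X, Y]`. An adjustment `η` adapted to `s` has the same two
properties. Hence `η - ω_u` takes values in `ker t`, vanishes on the image of `t`, and descends to
an `𝔞`-valued form on `𝔣` (`exists_descend`). Its symmetric part is `-B`, with `B` the adjusted
class; call its skew part `γ`. The Leibniz rule of `η` gives `δ(η + p^* B) = p^* B([·,·],·)`, so
`C_u` is the Chern-Weil cocycle of `B` minus `δγ`. This is the compatibility with `cw`.

Invariance of `KL` uses the same comparison. Two half splittings give forms that differ, up to an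
exact term, by a form from `𝔣`. For a butterfly with section `q`, the form `φ_q^* ω_{u₂} - f_q
ω_{u₁} - λ_q` descends to some `R_q` with `δR_q = C_{u₂} - C_{u₁}`. Invariance of the adjusted class
is easier: transport and morphisms of adjustments change `η` by skew terms only.

For injectivity, let `C_{u₂} - C_{u₁} = δR`, and let `e₁`, `e₂` be the retractions of `ι₁`, `ι₂`
determined by `u₁`, `u₂`. On the fibre product `𝔤₁ ×_𝔣 𝔤₂` the form `e₂ ω_{u₂} - e₁ ω_{u₁} - R` is
then a 2-cocycle, and its central extension by `𝔞` is an invertible butterfly (`Gluing.mor`) whose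
natural section has `R_q = R` (`Gluing.ι_R`). If the adjusted classes agree, `R = γ₁ - γ₂` is a
valid choice, and transport along this butterfly carries `η₁` exactly to `η₂`.

For surjectivity, let `𝔤 = x 𝔣[x]` with evaluation at `1` as `p`, and `b(X, Y) = -2 ∫₀¹ B(X', Y)`.
By invariance `b` satisfies the Leibniz rule; by integration by parts its symmetric part is `-p^*
B`. So `b` is a 2-cocycle on `ker p`, the central extension of `ker p` by `𝔞` is a crossed module
over `𝔤`, and `([X, Y] - s p [X, Y], b(X, Y))` is an adjustment with class `B`. Integrals of
polynomials are computed on coefficients, so no completeness is needed. -/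

theorem lcLieAlgebra_of_injective {L M : Type*} [LieRing L] [LieAlgebra ℝ L] [TopologicalSpace L]
    [LieRing M] [LieAlgebra ℝ M] [TopologicalSpace M] [LCLieAlgebra M] (f : L →ₗ⁅ℝ⁆ M)
    (hf : Topology.IsEmbedding f) : LCLieAlgebra L where
  toIsTopologicalAddGroup := hf.isInducing.topologicalAddGroup f
  toContinuousSMul := hf.isInducing.continuousSMul continuous_id (map_smul f _ _)
  toLocallyConvexSpace :=
    Topology.IsInducing.locallyConvexSpace (f := f.toLinearMap) hf.isInducing
  toT2Space := hf.t2Space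
  continuous_bracket := by
    rw [hf.continuous_iff]
    have e : f ∘ (fun v : L × L => ⁅v.1, v.2⁆) = fun v => ⁅f v.1, f v.2⁆ :=
      funext fun v => f.map_lie _ _
    rw [e]
    exact continuous_lie (hf.continuous.comp continuous_fst) (hf.continuous.comp continuous_snd)

instance LieSubalgebra.instLCLieAlgebra {L : Type*} [LieRing L] [LieAlgebra ℝ L]
    [TopologicalSpace L] [LCLieAlgebra L] (S : LieSubalgebra ℝ L) : LCLieAlgebra S :=
  lcLieAlgebra_of_injective S.incl Topology.IsEmbedding.subtypeVal

instance Prod.instLCLieAlgebra {L M : Type*} [LieRing L] [LieAlgebra ℝ L] [TopologicalSpace L]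
    [LCLieAlgebra L] [LieRing M] [LieAlgebra ℝ M] [TopologicalSpace M] [LCLieAlgebra M] :
    LCLieAlgebra (L × M) where
  continuous_bracket :=
    (continuous_lie (continuous_fst.comp continuous_fst)
      (continuous_fst.comp continuous_snd)).prodMk
    (continuous_lie (continuous_snd.comp continuous_fst) (continuous_snd.comp continuous_snd))

variable (L V : Type*) [LieRing L] [LieAlgebra ℝ L] [TopologicalSpace L]
  [AddCommGroup V] [Module ℝ V] [TopologicalSpace V]

/-- A continuous `2`-cocycle on `L` with values in the trivial module `V`. -/
structure TwoCocycle where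
  κ : L →ₗ[ℝ] L →ₗ[ℝ] V
  continuous_κ : Continuous fun v : L × L => κ v.1 v.2
  self : ∀ x, κ x x = 0
  leibniz : ∀ x y z, κ x ⁅y, z⁆ = κ ⁅x, y⁆ z + κ y ⁅x, z⁆

variable {L V}

/-- The central extension of `L` by `V` determined by a `2`-cocycle. -/
@[ext]
structure CentralExt (c : TwoCocycle L V) where
  fst : L
  snd : V

namespace CentralExt

variable {c : TwoCocycle L V}

/-- The underlying set of a central extension is a product. -/
def equivProd (c : TwoCocycle L V) : CentralExt c ≃ L × V where
  toFun x := (x.fst, x.snd)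
  invFun x := ⟨x.1, x.2⟩

instance : AddCommGroup (CentralExt c) := (equivProd c).addCommGroup

instance : Module ℝ (CentralExt c) := (equivProd c).module ℝ

instance : TopologicalSpace (CentralExt c) := TopologicalSpace.induced (equivProd c) inferInstance

@[simp] theorem fst_zero : (0 : CentralExt c).fst = 0 := rfl
@[simp] theorem snd_zero : (0 : CentralExt c).snd = 0 := rfl
@[simp] theorem fst_add (x y : CentralExt c) : (x + y).fst = x.fst + y.fst := rfl
@[simp] theorem snd_add (x y : CentralExt c) : (x + y).snd = x.snd + y.snd := rfl
@[simp] theorem fst_smul (r : ℝ) (x : CentralExt c) : (r • x).fst = r • x.fst := rfl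
@[simp] theorem snd_smul (r : ℝ) (x : CentralExt c) : (r • x).snd = r • x.snd := rfl

instance : LieRing (CentralExt c) where
  bracket x y := ⟨⁅x.fst, y.fst⁆, c.κ x.fst y.fst⟩
  add_lie x y z := by ext <;> simp
  lie_add x y z := by ext <;> simp
  lie_self x := by ext <;> simp [c.self]
  leibniz_lie x y z := by
    apply CentralExt.ext
    · exact leibniz_lie x.fst y.fst z.fst
    · exact c.leibniz _ _ _

@[simp] theorem fst_lie (x y : CentralExt c) : ⁅x, y⁆.fst = ⁅x.fst, y.fst⁆ := rfl
@[simp] theorem snd_lie (x y : CentralExt c) : ⁅x, y⁆.snd = c.κ x.fst y.fst := rfl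

instance : LieAlgebra ℝ (CentralExt c) where
  lie_smul r x y := by ext <;> simp

/-- The underlying vector space of a central extension is a product. -/
def linearEquivProd (c : TwoCocycle L V) : CentralExt c ≃ₗ[ℝ] L × V where
  toEquiv := equivProd c
  map_add' _ _ := rfl
  map_smul' _ _ := rfl

theorem isInducing_linearEquivProd : Topology.IsInducing (linearEquivProd c) := ⟨rfl⟩

theorem continuous_fst : Continuous (CentralExt.fst : CentralExt c → L) :=
  _root_.continuous_fst.comp isInducing_linearEquivProd.continuous

theorem continuous_snd : Continuous (CentralExt.snd : CentralExt c → V) :=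
  _root_.continuous_snd.comp isInducing_linearEquivProd.continuous

theorem continuous_mk {S : Type*} [TopologicalSpace S] {f : S → L} {g : S → V}
    (hf : Continuous f) (hg : Continuous g) : Continuous fun x => (⟨f x, g x⟩ : CentralExt c) :=
  isInducing_linearEquivProd.continuous_iff.2 (hf.prodMk hg)

instance [LCLieAlgebra L] [IsTopologicalAddGroup V] [ContinuousSMul ℝ V] [LocallyConvexSpace ℝ V]
    [T2Space V] : LCLieAlgebra (CentralExt c) where
  toIsTopologicalAddGroup := isInducing_linearEquivProd.topologicalAddGroup (linearEquivProd c)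
  toContinuousSMul := isInducing_linearEquivProd.continuousSMul continuous_id
    (map_smul (linearEquivProd c) _ _)
  toLocallyConvexSpace := Topology.IsInducing.locallyConvexSpace
    (f := (linearEquivProd c).toLinearMap) isInducing_linearEquivProd
  toT2Space := T2Space.of_injective_continuous (linearEquivProd c).injective
    isInducing_linearEquivProd.continuous
  continuous_bracket := continuous_mk
    (continuous_lie (continuous_fst.comp _root_.continuous_fst)
      (continuous_fst.comp _root_.continuous_snd))
    (c.continuous_κ.comp ((continuous_fst.comp _root_.continuous_fst).prodMk
      (continuous_fst.comp _root_.continuous_snd)))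

end CentralExt

end Constructions

/-! ### Bilinear forms and their Chevalley-Eilenberg differential -/

section Forms

/-- The Lie bracket as a bilinear map. -/
def lieBilin (L : Type*) [LieRing L] [LieAlgebra ℝ L] : L →ₗ[ℝ] L →ₗ[ℝ] L :=
  LinearMap.mk₂ ℝ (fun x y => ⁅x, y⁆) add_lie smul_lie lie_add lie_smul

@[simp] theorem lieBilin_apply {L : Type*} [LieRing L] [LieAlgebra ℝ L] (x y : L) :
    lieBilin L x y = ⁅x, y⁆ := rfl

/-- The Chevalley-Eilenberg differential of a function of two variables. -/
def ceDiff₂ {L V : Type*} [LieRing L] [AddCommGroup V] (f : L → L → V) (x y z : L) : V :=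
  -f ⁅x, y⁆ z + f ⁅x, z⁆ y - f ⁅y, z⁆ x

variable {L V : Type*} [LieRing L] [LieAlgebra ℝ L] [TopologicalSpace L]
  [AddCommGroup V] [Module ℝ V] [TopologicalSpace V]

/-- A continuous alternating `2`-form from a skew-symmetric bilinear map. -/
def alt2 (f : L →ₗ[ℝ] L →ₗ[ℝ] V) (hf : Continuous fun v : L × L => f v.1 v.2)
    (hskew : ∀ x y, f y x = -f x y) : L [⋀^Fin 2]→L[ℝ] V where
  toFun v := f (v 0) (v 1)
  map_update_add' := by
    intro inst m i x y
    obtain rfl : inst = instDecidableEqFin 2 := Subsingleton.elim _ _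
    fin_cases i <;> simp
  map_update_smul' := by
    intro inst m i c x
    obtain rfl : inst = instDecidableEqFin 2 := Subsingleton.elim _ _
    fin_cases i <;> simp
  map_eq_zero_of_eq' := by
    have h0 : ∀ x, f x x = 0 := fun x => by
      have h : (2 : ℝ) • f x x = 0 := by
        rw [two_smul]
        nth_rewrite 2 [hskew x x]
        exact add_neg_cancel _
      exact (smul_eq_zero.1 h).resolve_left two_ne_zero
    intro v i j hij hne
    have key : v 0 = v 1 := by
      fin_cases i <;> fin_cases j
      · exact absurd rfl hne
      · exact hij
      · exact hij.symm
      · exact absurd rfl hne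
    rw [key, h0]
  cont := by
    have h : Continuous fun v : Fin 2 → L => ((v 0, v 1) : L × L) :=
      (continuous_apply 0).prodMk (continuous_apply 1)
    exact hf.comp h

/-- Inverse to `alt2`: cochains in degree two can be handled as skew bilinear maps throughout. -/
theorem _root_.ContinuousAlternatingMap.exists_bilin (θ : L [⋀^Fin 2]→L[ℝ] V) :
    ∃ f : L →ₗ[ℝ] L →ₗ[ℝ] V, (Continuous fun v : L × L => f v.1 v.2) ∧ (∀ x y, f y x = -f x y) ∧
      ∀ x y, θ ![x, y] = f x y := by
  have skew : ∀ x y, θ ![y, x] = -θ ![x, y] := fun x y => by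
    have h := θ.toAlternatingMap.map_swap ![x, y] (i := 0) (j := 1) (by decide)
    have e : ![x, y] ∘ Equiv.swap (0 : Fin 2) 1 = ![y, x] := by
      funext i; fin_cases i <;> simp
    rw [e] at h
    exact h
  have add : ∀ x x' y, θ ![x + x', y] = θ ![x, y] + θ ![x', y] := fun x x' y =>
    θ.toAlternatingMap.toMultilinearMap.cons_add ![y] x x'
  have smul : ∀ (c : ℝ) x y, θ ![c • x, y] = c • θ ![x, y] := fun c x y =>
    θ.toAlternatingMap.toMultilinearMap.cons_smul ![y] c x
  refine ⟨LinearMap.mk₂ ℝ (fun x y => θ ![x, y]) add smul (fun x y y' => ?_) (fun c x y => ?_),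
    ?_, skew, fun x y => rfl⟩
  · rw [skew (y + y'), add, skew y, skew y']; abel
  · rw [skew (c • y), smul, skew y, smul_neg]
  · refine θ.cont.comp (continuous_pi fun i => ?_)
    fin_cases i
    · exact continuous_fst
    · exact continuous_snd

variable [IsTopologicalAddGroup V] [ContinuousConstSMul ℝ V]

/-- Two `3`-cocycles are cohomologous iff their difference is the differential of a continuous
skew-symmetric bilinear map. -/
theorem H3.mk_eq_mk_iff (a b : cocycles L V 2) :
    (Submodule.Quotient.mk a : H3 L V) = Submodule.Quotient.mk b ↔
      ∃ f : L →ₗ[ℝ] L →ₗ[ℝ] V, (Continuous fun v : L × L => f v.1 v.2) ∧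
        (∀ x y, f y x = -f x y) ∧
        ∀ x y z, a.1 ![x, y, z] - b.1 ![x, y, z] = ceDiff₂ (fun x y => f x y) x y z := by
  rw [Submodule.Quotient.eq]
  change (∃ θ : L [⋀^Fin 2]→L[ℝ] V, ∀ X, (a - b).1 X = ceDiff θ X) ↔ _
  constructor
  · rintro ⟨θ, hθ⟩
    obtain ⟨f, hf, hs, hfθ⟩ := θ.exists_bilin
    refine ⟨f, hf, hs, fun x y z => (hθ ![x, y, z]).trans ?_⟩
    rw [ceDiff_two, hfθ, hfθ, hfθ, ceDiff₂]
  · rintro ⟨f, hf, hs, h⟩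
    refine ⟨alt2 f hf hs, fun v => ?_⟩
    rw [vec3 v, ceDiff_two]
    exact h _ _ _

end Forms

/-- The Jacobi identity in the shape of `ceDiff₂`. Composed with a linear map it says that `δ ∘ δ`
vanishes on 1-cochains. -/
theorem ceDiff₂_lie {L : Type*} [LieRing L] (x y z : L) :
    -⁅⁅x, y⁆, z⁆ + ⁅⁅x, z⁆, y⁆ - ⁅⁅y, z⁆, x⁆ = 0 := by
  rw [lie_lie x y z, ← lie_skew ⁅x, z⁆ y, ← lie_skew ⁅y, z⁆ x]
  abel

namespace CrossedModule

variable {G : CrossedModule.{u}} (u : G.𝔤 →L[ℝ] G.𝔥)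

/-- `ω_u` as a bilinear map. -/
def omegaBilin : G.𝔤 →ₗ[ℝ] G.𝔤 →ₗ[ℝ] G.𝔥 :=
  LinearMap.mk₂ ℝ (G.omega u) omega_add_left omega_smul_left
    (fun X Y Y' => by
      rw [omega_skew (Y + Y') X, omega_skew Y X, omega_skew Y' X, omega_add_left]; abel)
    (fun c X Y => by rw [omega_skew (c • Y) X, omega_skew Y X, omega_smul_left, smul_neg])

@[simp] theorem omegaBilin_apply (X Y : G.𝔤) : omegaBilin u X Y = G.omega u X Y := rfl

theorem omega_sub_left (X X' Y : G.𝔤) :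
    G.omega u (X - X') Y = G.omega u X Y - G.omega u X' Y := by
  simp only [← omegaBilin_apply, map_sub, LinearMap.sub_apply]

end CrossedModule

section FixedHomotopy

set_option linter.unusedSectionVars false

variable {𝔣 𝔞 : Type u} [LieRing 𝔣] [LieAlgebra ℝ 𝔣] [TopologicalSpace 𝔣] [LCLieAlgebra 𝔣]
  [LieRing 𝔞] [LieAlgebra ℝ 𝔞] [TopologicalSpace 𝔞] [LCLieAlgebra 𝔞]

/-! ### Descent of forms to `𝔣` and independence of the half splitting. -/

namespace CrMod

variable {G G₁ G₂ : CrMod 𝔣 𝔞}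

/-- The map `id - s p` has values in the image of `t`, where `t u` is the identity for any half
splitting `u`; so `u ∘ (id - s p)` works. -/
theorem exists_extension {s : 𝔣 →L[ℝ] G.𝔤} (hs : G.IsSection s) :
    ∃ u : G.𝔤 →L[ℝ] G.𝔥, ∀ X, G.t (u X) = X - s (G.p X) := by
  obtain ⟨u, hu, -⟩ := G.separable
  let P : G.𝔤 →L[ℝ] 𝔣 := ⟨G.p.toLinearMap, G.isQuotientMap_p.continuous⟩
  refine ⟨u ∘L (ContinuousLinearMap.id ℝ G.𝔤 - s ∘L P), fun X => ?_⟩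
  obtain ⟨y, hy⟩ := (G.ker_p (X - s (G.p X))).1 (by rw [map_sub, hs, sub_self])
  change G.t (u (X - s (G.p X))) = _
  rw [← hy, hu]

theorem isHalfSplitting_of_extends {s : 𝔣 →L[ℝ] G.𝔤} {u : G.𝔤 →L[ℝ] G.𝔥}
    (h : ∀ X, G.t (u X) = X - s (G.p X)) : G.IsHalfSplitting u := fun y => by
  rw [h, p_t, map_zero, sub_zero]

theorem klCocycle_spec₂ (u : G.𝔤 →L[ℝ] G.𝔥) (hu : G.IsHalfSplitting u) (X Y Z : G.𝔤) :
    G.ι ((G.klCocycle u hu).1 ![G.p X, G.p Y, G.p Z]) = ceDiff₂ (G.omega u) X Y Z := by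
  rw [klCocycle_spec, ceDiff_two]
  rfl

/-- A continuous bilinear map on `𝔤₁` with values in `ker t₂` that vanishes on the image of `t₁`
descends to a continuous bilinear map on `𝔣` with values in `𝔞`. -/
theorem exists_descend (E : G₁.𝔤 →ₗ[ℝ] G₁.𝔤 →ₗ[ℝ] G₂.𝔥)
    (hE : Continuous fun v : G₁.𝔤 × G₁.𝔤 => E v.1 v.2) (ht : ∀ X Y, G₂.t (E X Y) = 0)
    (hl : ∀ y X, E (G₁.t y) X = 0) (hr : ∀ X y, E X (G₁.t y) = 0) :
    ∃ β : 𝔣 →ₗ[ℝ] 𝔣 →ₗ[ℝ] 𝔞, (Continuous fun v : 𝔣 × 𝔣 => β v.1 v.2) ∧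
      ∀ X Y, G₂.ι (β (G₁.p X) (G₁.p Y)) = E X Y := by
  have hι := G₂.isEmbedding_ι.injective
  -- A continuous section makes the descended form continuous: `ι β` is the pullback of `E` along
  -- it.
  obtain ⟨u, hu, -⟩ := G₁.separable
  obtain ⟨s, hs, -⟩ := exists_section hu
  have hsl : ∀ X Y, E (s (G₁.p X)) Y = E X Y := fun X Y => by
    obtain ⟨y, hy⟩ := (G₁.ker_p (X - s (G₁.p X))).1 (by rw [map_sub, hs, sub_self])
    have h := hl y Y
    rw [hy, map_sub, LinearMap.sub_apply, sub_eq_zero] at h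
    exact h.symm
  have hsr : ∀ X Y, E X (s (G₁.p Y)) = E X Y := fun X Y => by
    obtain ⟨y, hy⟩ := (G₁.ker_p (Y - s (G₁.p Y))).1 (by rw [map_sub, hs, sub_self])
    have h := hr X y
    rw [hy, map_sub, sub_eq_zero] at h
    exact h.symm
  have hβ : ∀ x y, ∃ b, G₂.ι b = E (s x) (s y) := fun x y => (G₂.range_ι _).2 (ht _ _)
  choose β hβ using hβ
  refine ⟨LinearMap.mk₂ ℝ β (fun x x' y => hι ?_) (fun c x y => hι ?_) (fun x y y' => hι ?_)
    (fun c x y => hι ?_), ?_, fun X Y => ?_⟩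
  · simp only [map_add, hβ, LinearMap.add_apply]
  · simp only [map_smul, hβ, LinearMap.smul_apply]
  · simp only [map_add, hβ]
  · simp only [map_smul, hβ]
  · change Continuous fun v : 𝔣 × 𝔣 => β v.1 v.2
    rw [G₂.isEmbedding_ι.continuous_iff]
    have e : G₂.ι ∘ (fun v : 𝔣 × 𝔣 => β v.1 v.2) = fun v => E (s v.1) (s v.2) :=
      funext fun v => hβ _ _
    rw [e]
    exact hE.comp ((s.continuous.comp continuous_fst).prodMk (s.continuous.comp continuous_snd))
  · change G₂.ι (β _ _) = _
    rw [hβ, hsl, hsr]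

theorem ι_ceDiff₂ {E : G₁.𝔤 → G₁.𝔤 → G₂.𝔥} {β : 𝔣 → 𝔣 → 𝔞}
    (h : ∀ X Y, G₂.ι (β (G₁.p X) (G₁.p Y)) = E X Y) (X Y Z : G₁.𝔤) :
    G₂.ι (ceDiff₂ β (G₁.p X) (G₁.p Y) (G₁.p Z)) = ceDiff₂ E X Y Z := by
  simp only [ceDiff₂, ← LieHom.map_lie, map_sub, map_add, map_neg, h]

theorem skew_of_ι_eq {E : G₁.𝔤 → G₁.𝔤 → G₂.𝔥} {β : 𝔣 → 𝔣 → 𝔞}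
    (h : ∀ X Y, G₂.ι (β (G₁.p X) (G₁.p Y)) = E X Y) (hE : ∀ X Y, E Y X = -E X Y) (x y : 𝔣) :
    β y x = -β x y := by
  obtain ⟨X, rfl⟩ := G₁.isQuotientMap_p.surjective x
  obtain ⟨Y, rfl⟩ := G₁.isQuotientMap_p.surjective y
  apply G₂.isEmbedding_ι.injective
  rw [map_neg, h, h, hE]

/-- The Kassel-Loday class does not depend on the half splitting. -/
theorem klClass_eq {u u' : G.𝔤 →L[ℝ] G.𝔥} (hu : G.IsHalfSplitting u)
    (hu' : G.IsHalfSplitting u') : G.klClass u hu = G.klClass u' hu' := by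
  have hι := G.isEmbedding_ι.injective
  obtain ⟨s, hs, hsp⟩ := exists_section hu
  obtain ⟨s', hs', hsp'⟩ := exists_section hu'
  -- Since `s - s'` has values in the image of `t`, this lifts it: `t φ = s - s'`.
  let φ : 𝔣 →L[ℝ] G.𝔥 := u ∘L (s - s')
  have hφ : ∀ x, G.t (φ x) = s x - s' x := fun x => by
    obtain ⟨y, hy⟩ := (G.ker_p (s x - s' x)).1 (by rw [map_sub, hs, hs', sub_self])
    change G.t (u (s x - s' x)) = _
    rw [← hy, hu]
  -- This is `ω_u - ω_{u'} - δ(p^* φ)`. The last term cancels the difference of the sections under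
  -- `t`, and being exact it does not contribute to the differential (`hj` below).
  let E : G.𝔤 →ₗ[ℝ] G.𝔤 →ₗ[ℝ] G.𝔥 := CrossedModule.omegaBilin u - CrossedModule.omegaBilin u' +
    (lieBilin G.𝔤).compr₂ (φ.toLinearMap ∘ₗ G.p.toLinearMap)
  have hE : ∀ X Y, E X Y = G.omega u X Y - G.omega u' X Y + φ (G.p ⁅X, Y⁆) := fun _ _ => rfl
  obtain ⟨β, hβ, hβE⟩ := exists_descend (G₁ := G) (G₂ := G) E
    (by
      have hb : Continuous fun v : G.𝔤 × G.𝔤 => ⁅v.1, v.2⁆ :=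
        continuous_lie continuous_fst continuous_snd
      exact (CrossedModule.continuous_omega.sub CrossedModule.continuous_omega).add
        (φ.continuous.comp (G.isQuotientMap_p.continuous.comp hb)))
    (fun X Y => by
      rw [hE, map_add, map_sub, CrossedModule.t_omega hu, CrossedModule.t_omega hu', hφ,
        hsp, hsp']
      abel)
    (fun y X => by
      rw [hE, CrossedModule.omega_t_left G.central hu, CrossedModule.omega_t_left G.central hu',
        LieHom.map_lie, p_t, zero_lie, map_zero, sub_self, add_zero])
    (fun X y => by
      rw [hE, CrossedModule.omega_t G.central hu, CrossedModule.omega_t G.central hu',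
        LieHom.map_lie, p_t, lie_zero, map_zero, sub_self, add_zero])
  refine (H3.mk_eq_mk_iff _ _).2 ⟨β, hβ, skew_of_ι_eq hβE fun X Y => ?_, fun x y z => ?_⟩
  · rw [hE, hE, CrossedModule.omega_skew X Y, CrossedModule.omega_skew X Y, ← lie_skew X Y,
      map_neg, map_neg]
    abel
  · obtain ⟨X, rfl⟩ := G.isQuotientMap_p.surjective x
    obtain ⟨Y, rfl⟩ := G.isQuotientMap_p.surjective y
    obtain ⟨Z, rfl⟩ := G.isQuotientMap_p.surjective z
    apply hι
    rw [ι_ceDiff₂ hβE, map_sub, klCocycle_spec₂, klCocycle_spec₂]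
    have hj : -φ (G.p ⁅⁅X, Y⁆, Z⁆) + φ (G.p ⁅⁅X, Z⁆, Y⁆) - φ (G.p ⁅⁅Y, Z⁆, X⁆) = 0 := by
      rw [← map_neg, ← map_neg, ← map_add, ← map_add, ← map_sub, ← map_sub, ceDiff₂_lie,
        map_zero, map_zero]
    rw [← add_zero (ceDiff₂ (G.omega u) X Y Z - _), ← hj]
    simp only [ceDiff₂, hE]
    abel

end CrMod

/-! ### Butterflies -/

namespace Butterfly

variable {H₁ H₂ : CrossedModule.{u}} {k : Butterfly H₁ H₂}

theorem nonempty_sec (k : Butterfly H₁ H₂) : Nonempty k.Sec := by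
  obtain ⟨-, q, j, hq, -, hqj⟩ := k.exact
  exact ⟨⟨q, j, hq, hqj⟩⟩

theorem i₂_injective (k : Butterfly H₁ H₂) : Function.Injective k.i₂ := by
  obtain ⟨-, q, j, -, hj, -⟩ := k.exact
  exact Function.LeftInverse.injective hj

theorem r₁_i₂ (k : Butterfly H₁ H₂) (y : H₂.𝔥) : k.r₁ (k.i₂ y) = 0 := k.exact.1 y

namespace Sec

variable (σ : k.Sec)

theorem j_i₂ (y : H₂.𝔥) : σ.j (k.i₂ y) = y := k.i₂_injective <| by
  have h := σ.i₂_j (k.i₂ y)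
  rwa [k.r₁_i₂, map_zero, add_zero] at h

/-- This is `i₂ j + q r₁ = id` evaluated at `i₁ y`. It identifies `f` as the failure of `q t₁ = i₁`.
-/
theorem q_t (y : H₁.𝔥) : σ.q (H₁.t y) = k.i₁ y + k.i₂ (σ.f y) := by
  rw [← k.r₁_i₁, f, map_neg, ← sub_eq_add_neg, eq_sub_iff_add_eq', σ.i₂_j]

theorem t_f (y : H₁.𝔥) : H₂.t (σ.f y) = σ.φ (H₁.t y) := by
  rw [φ, q_t, map_add, k.r₂_i₁, zero_add, k.r₂_i₂]

theorem i₂_lam (X Y : H₁.𝔤) : k.i₂ (σ.lam X Y) = ⁅σ.q X, σ.q Y⁆ - σ.q ⁅X, Y⁆ := by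
  have h := σ.i₂_j ⁅σ.q X, σ.q Y⁆
  rw [LieHom.map_lie, σ.r₁_q, σ.r₁_q] at h
  rw [lam, eq_sub_iff_add_eq, h]

theorem q_lie (X Y : H₁.𝔤) : σ.q ⁅X, Y⁆ = ⁅σ.q X, σ.q Y⁆ - k.i₂ (σ.lam X Y) := by
  rw [i₂_lam]; abel

theorem t_lam (X Y : H₁.𝔤) : H₂.t (σ.lam X Y) = ⁅σ.φ X, σ.φ Y⁆ - σ.φ ⁅X, Y⁆ := by
  rw [← k.r₂_i₂, i₂_lam, map_sub, LieHom.map_lie]; rfl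

theorem φ_lie (X Y : H₁.𝔤) : σ.φ ⁅X, Y⁆ = ⁅σ.φ X, σ.φ Y⁆ - H₂.t (σ.lam X Y) := by
  rw [t_lam]; abel

/-- Bracket the decomposition `q_t` with `q X`: the `i₁` and `i₂` parts become the two actions. This
is the boundary behaviour of `λ_q` that makes the defect vanish on the image of `t₁`. -/
theorem lam_t (X : H₁.𝔤) (y : H₁.𝔥) :
    σ.lam X (H₁.t y) = H₂.α (σ.φ X) (σ.f y) - σ.f (H₁.α X y) := by
  have h : ⁅σ.q X, k.i₁ y⁆ = k.i₁ (H₁.α X y) := by rw [← k.i₁_α, σ.r₁_q]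
  rw [lam, q_t, lie_add, ← k.i₂_α, map_add, j_i₂, h, f, f, φ]
  abel

theorem lam_skew (X Y : H₁.𝔤) : σ.lam Y X = -σ.lam X Y := by
  rw [lam, ← lie_skew, map_neg]; rfl

theorem f_neg (y : H₁.𝔥) : σ.f (-y) = -σ.f y := by simp only [f, map_neg]
theorem f_add (y z : H₁.𝔥) : σ.f (y + z) = σ.f y + σ.f z := by
  simp only [f, map_add]; abel
theorem f_sub (y z : H₁.𝔥) : σ.f (y - z) = σ.f y - σ.f z := by
  simp only [f, map_sub]; abel

/-- `φ_q` as a continuous linear map. -/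
def φL : H₁.𝔤 →L[ℝ] H₂.𝔤 := (⟨k.r₂.toLinearMap, k.continuous_r₂⟩ : k.𝔨 →L[ℝ] H₂.𝔤) ∘L σ.q

@[simp] theorem φL_apply (X : H₁.𝔤) : σ.φL X = σ.φ X := rfl

/-- `f_q` as a continuous linear map. -/
def fL : H₁.𝔥 →L[ℝ] H₂.𝔥 := -(σ.j ∘L (⟨k.i₁.toLinearMap, k.continuous_i₁⟩ : H₁.𝔥 →L[ℝ] k.𝔨))

/-- The form `φ_q^* ω_{u₂} - f_q ω_{u₁} - λ_q`. -/
def defect (u₁ : H₁.𝔤 →L[ℝ] H₁.𝔥) (u₂ : H₂.𝔤 →L[ℝ] H₂.𝔥) : H₁.𝔤 →ₗ[ℝ] H₁.𝔤 →ₗ[ℝ] H₂.𝔥 :=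
  (CrossedModule.omegaBilin u₂).compl₁₂ σ.φL.toLinearMap σ.φL.toLinearMap -
    (CrossedModule.omegaBilin u₁).compr₂ σ.fL.toLinearMap -
    ((lieBilin k.𝔨).compl₁₂ σ.q.toLinearMap σ.q.toLinearMap).compr₂ σ.j.toLinearMap

variable (u₁ : H₁.𝔤 →L[ℝ] H₁.𝔥) (u₂ : H₂.𝔤 →L[ℝ] H₂.𝔥)

theorem defect_apply (X Y : H₁.𝔤) : σ.defect u₁ u₂ X Y =
    H₂.omega u₂ (σ.φ X) (σ.φ Y) - σ.f (H₁.omega u₁ X Y) - σ.lam X Y := rfl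

theorem defect_skew (X Y : H₁.𝔤) : σ.defect u₁ u₂ Y X = -σ.defect u₁ u₂ X Y := by
  rw [defect_apply, defect_apply, CrossedModule.omega_skew (σ.φ X), CrossedModule.omega_skew X,
    lam_skew, f_neg]
  abel

theorem continuous_defect :
    Continuous fun v : H₁.𝔤 × H₁.𝔤 => σ.defect u₁ u₂ v.1 v.2 := by
  have h1 : Continuous fun v : H₁.𝔤 × H₁.𝔤 => H₂.omega u₂ (σ.φL v.1) (σ.φL v.2) :=
    CrossedModule.continuous_omega.comp ((σ.φL.continuous.comp continuous_fst).prodMk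
      (σ.φL.continuous.comp continuous_snd))
  have h2 : Continuous fun v : H₁.𝔤 × H₁.𝔤 => σ.fL (H₁.omega u₁ v.1 v.2) :=
    σ.fL.continuous.comp CrossedModule.continuous_omega
  have h3 : Continuous fun v : H₁.𝔤 × H₁.𝔤 => σ.j ⁅σ.q v.1, σ.q v.2⁆ :=
    σ.j.continuous.comp (continuous_lie (σ.q.continuous.comp continuous_fst)
      (σ.q.continuous.comp continuous_snd))
  exact (h1.sub h2).sub h3

variable {u₁ u₂}

theorem defect_t (hc₁ : H₁.IsCentral) (hc₂ : H₂.IsCentral) (hu₁ : H₁.IsHalfSplitting u₁)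
    (hu₂ : H₂.IsHalfSplitting u₂) (X : H₁.𝔤) (y : H₁.𝔥) :
    σ.defect u₁ u₂ X (H₁.t y) = 0 := by
  rw [defect_apply, CrossedModule.omega_t hc₁ hu₁, lam_t, ← t_f, CrossedModule.omega_t hc₂ hu₂]
  abel

/-- Neither `φ_q` nor `q` is a homomorphism; both errors are given by `λ_q`. In `ω_{u₂}(φ[X, Y],
φZ)` and in `λ([X, Y], Z)` they produce the same term `α₂(φZ, λ(X, Y))`, which cancels. What remains
of `λ` is a triple bracket in `𝔨`, killed by Jacobi. -/
theorem ceDiff₂_defect (hc₂ : H₂.IsCentral) (hu₂ : H₂.IsHalfSplitting u₂) (X Y Z : H₁.𝔤) :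
    ceDiff₂ (fun X Y => σ.defect u₁ u₂ X Y) X Y Z =
      ceDiff₂ (H₂.omega u₂) (σ.φ X) (σ.φ Y) (σ.φ Z) - σ.f (ceDiff₂ (H₁.omega u₁) X Y Z) := by
  have key : ∀ X Y Z : H₁.𝔤, σ.defect u₁ u₂ ⁅X, Y⁆ Z =
      H₂.omega u₂ ⁅σ.φ X, σ.φ Y⁆ (σ.φ Z) - σ.f (H₁.omega u₁ ⁅X, Y⁆ Z) -
        σ.j ⁅⁅σ.q X, σ.q Y⁆, σ.q Z⁆ := fun X Y Z => by
    rw [defect_apply, φ_lie, CrossedModule.omega_sub_left, CrossedModule.omega_t_left hc₂ hu₂,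
      lam.eq_1 σ ⁅X, Y⁆ Z, q_lie, sub_lie, ← lie_skew (k.i₂ _) (σ.q Z), ← k.i₂_α, map_sub, map_neg, j_i₂]
    change _ - - H₂.α (σ.φ Z) _ - _ - (_ - -H₂.α (σ.φ Z) _) = _
    abel
  have hj := congrArg σ.j (ceDiff₂_lie (σ.q X) (σ.q Y) (σ.q Z))
  rw [map_sub, map_add, map_neg, map_zero] at hj
  simp only [ceDiff₂, key, f_sub, f_add, f_neg]
  rw [← add_zero (_ - (_ : H₂.𝔥)), ← hj]
  abel

end Sec

end Butterfly

/-! ### Invariance of the Kassel-Loday class under morphisms. -/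

namespace CrMod.Mor

variable {G₁ G₂ : CrMod 𝔣 𝔞} (k : CrMod.Mor G₁ G₂) (σ : k.toButterfly.Sec)

theorem p_φ (X : G₁.𝔤) : G₂.p (σ.φ X) = G₁.p X := by
  rw [Butterfly.Sec.φ, k.π₀_eq, σ.r₁_q]

theorem f_ι (a : 𝔞) : σ.f (G₁.ι a) = G₂.ι a := by
  rw [Butterfly.Sec.f, ← map_neg, ← k.π₁_eq, σ.j_i₂]

/-- The Kassel-Loday class is invariant under invertible butterflies. -/
theorem klClass_eq (k : CrMod.Mor G₁ G₂) {u₁ : G₁.𝔤 →L[ℝ] G₁.𝔥} {u₂ : G₂.𝔤 →L[ℝ] G₂.𝔥} (hu₁ : G₁.IsHalfSplitting u₁)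
    (hu₂ : G₂.IsHalfSplitting u₂) : G₁.klClass u₁ hu₁ = G₂.klClass u₂ hu₂ := by
  have hι := G₂.isEmbedding_ι.injective
  obtain ⟨σ⟩ := k.toButterfly.nonempty_sec
  obtain ⟨s, hs, hsp⟩ := exists_section hu₁
  -- The half splitting on `G₂` may be chosen freely. Extending the transported section `φ_q s` is
  -- what puts the defect into `ker t₂`.
  have hs₂ : G₂.IsSection (σ.φL ∘L s) := fun x => (k.p_φ σ _).trans (hs x)
  obtain ⟨v, hv⟩ := exists_extension hs₂
  have hv' := isHalfSplitting_of_extends hv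
  rw [CrMod.klClass_eq hu₂ hv']
  have hd := σ.defect_t G₁.central G₂.central hu₁ hv'
  obtain ⟨β, hβ, hβE⟩ := exists_descend (σ.defect u₁ v) (σ.continuous_defect u₁ v)
    (fun X Y => by
      rw [σ.defect_apply, map_sub, map_sub, CrossedModule.t_omega hv', σ.t_f, σ.t_lam,
        CrossedModule.t_omega hu₁, hv, LieHom.map_lie, k.p_φ, k.p_φ, ← LieHom.map_lie]
      have h : G₁.t (u₁ ⁅X, Y⁆) = ⁅X, Y⁆ - s (G₁.p ⁅X, Y⁆) := by rw [hsp]; abel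
      rw [h, ← σ.φL_apply (_ - _), map_sub]
      simp only [Butterfly.Sec.φL_apply, ContinuousLinearMap.comp_apply]
      abel)
    (fun y X => by rw [σ.defect_skew, hd, neg_zero]) hd
  refine ((H3.mk_eq_mk_iff _ _).2 ⟨β, hβ, skew_of_ι_eq hβE (σ.defect_skew _ _),
    fun x y z => ?_⟩).symm
  obtain ⟨X, rfl⟩ := G₁.isQuotientMap_p.surjective x
  obtain ⟨Y, rfl⟩ := G₁.isQuotientMap_p.surjective y
  obtain ⟨Z, rfl⟩ := G₁.isQuotientMap_p.surjective z
  apply hι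
  rw [ι_ceDiff₂ hβE, σ.ceDiff₂_defect G₂.central hv', ← klCocycle_spec₂ v hv',
    ← klCocycle_spec₂ u₁ hu₁, k.p_φ, k.p_φ, k.p_φ, map_sub, k.f_ι]

end CrMod.Mor

end FixedHomotopy

section FixedHomotopy

set_option linter.unusedSectionVars false

variable {𝔣 𝔞 : Type u} [LieRing 𝔣] [LieAlgebra ℝ 𝔣] [TopologicalSpace 𝔣] [LCLieAlgebra 𝔣]
  [LieRing 𝔞] [LieAlgebra ℝ 𝔞] [TopologicalSpace 𝔞] [LCLieAlgebra 𝔞]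

/-! ### Adjustments and the Chern-Weil homomorphism -/

namespace AdaptedAdjustment

variable {G : CrMod 𝔣 𝔞} (a : AdaptedAdjustment G)

theorem adjustedKL_unique {B : Sym2Ad 𝔣 𝔞}
    (h : ∀ X Y, (1 / 2 : ℝ) • (a.η X Y + a.η Y X) = -G.ι (B.1 (G.p X) (G.p Y))) :
    a.adjustedKL = B :=
  (existsUnique_adjustedKL a).unique a.adjustedKL_spec h

theorem η_symm (X Y : G.𝔤) :
    a.η Y X = -a.η X Y - (2 : ℝ) • G.ι (a.adjustedKL.1 (G.p X) (G.p Y)) := by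
  have h := congrArg (fun v => (2 : ℝ) • v) (a.adjustedKL_spec X Y)
  simp only [smul_smul, mul_one_div_cancel (two_ne_zero' ℝ), one_smul, smul_neg] at h
  rw [sub_eq_add_neg, ← h]
  abel

/-- The difference of an adapted adjustment and `ω_u` descends to `𝔣`; its skew-symmetric part
relates the Kassel-Loday cocycle to the Chern-Weil cocycle. -/
theorem exists_skew_part {u : G.𝔤 →L[ℝ] G.𝔥} (hu : ∀ X, G.t (u X) = X - a.s (G.p X)) :
    ∃ γ : 𝔣 →ₗ[ℝ] 𝔣 →ₗ[ℝ] 𝔞, (Continuous fun v : 𝔣 × 𝔣 => γ v.1 v.2) ∧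
      (∀ x y, γ y x = -γ x y) ∧
      ∀ X Y, G.ι (γ (G.p X) (G.p Y)) =
        a.η X Y - G.omega u X Y + G.ι (a.adjustedKL.1 (G.p X) (G.p Y)) := by
  have hu' := CrMod.isHalfSplitting_of_extends hu
  let P : 𝔣 →ₗ[ℝ] 𝔣 →ₗ[ℝ] 𝔞 := a.adjustedKL.1
  let E : G.𝔤 →ₗ[ℝ] G.𝔤 →ₗ[ℝ] G.𝔥 := a.η - CrossedModule.omegaBilin u +
    (P.compl₁₂ G.p.toLinearMap G.p.toLinearMap).compr₂ G.ι.toLinearMap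
  have hE : ∀ X Y, E X Y = a.η X Y - G.omega u X Y + G.ι (a.adjustedKL.1 (G.p X) (G.p Y)) :=
    fun _ _ => rfl
  obtain ⟨γ, hγ, hγE⟩ := CrMod.exists_descend (G₁ := G) (G₂ := G) E
    (by
      have hp := G.isQuotientMap_p.continuous
      have hB : Continuous fun v : G.𝔤 × G.𝔤 => G.ι (a.adjustedKL.1 (G.p v.1) (G.p v.2)) :=
        G.isEmbedding_ι.continuous.comp ((Sym2Ad.continuous a.adjustedKL).comp
          ((hp.comp continuous_fst).prodMk (hp.comp continuous_snd)))
      exact (a.continuous_η.sub CrossedModule.continuous_omega).add hB)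
    (fun X Y => by
      rw [hE, map_add, map_sub, CrossedModule.t_omega hu', CrMod.ι_mem, a.adapted, hu, sub_self,
        add_zero])
    (fun y X => by
      rw [hE, CrossedModule.omega_t_left G.central hu', a.η_t_left, CrMod.p_t, map_zero,
        LinearMap.zero_apply, map_zero, sub_self, add_zero])
    (fun X y => by
      rw [hE, CrossedModule.omega_t G.central hu', a.η_t_right, CrMod.p_t, map_zero, map_zero,
        sub_self, add_zero])
  refine ⟨γ, hγ, CrMod.skew_of_ι_eq hγE fun X Y => ?_, hγE⟩
  rw [hE, hE, CrossedModule.omega_skew X Y, a.η_symm X Y, Sym2Ad.symm a.adjustedKL (G.p Y),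
    two_smul]
  abel

/-- Adding `p^* B` leaves the skew part of `η`. The Leibniz rule of `η` then cancels all `η` terms,
and invariance turns each `B` term into a multiple of `B([X, Y], Z)`. -/
theorem ceDiff₂_η (X Y Z : G.𝔤) :
    ceDiff₂ (fun X Y => a.η X Y + G.ι (a.adjustedKL.1 (G.p X) (G.p Y))) X Y Z =
      G.ι (a.adjustedKL.1 ⁅G.p X, G.p Y⁆ (G.p Z)) := by
  have h1 := Sym2Ad.invariant a.adjustedKL (G.p X) (G.p Y) (G.p Z)
  have h2 : a.adjustedKL.1 ⁅G.p X, G.p Z⁆ (G.p Y) = -a.adjustedKL.1 ⁅G.p X, G.p Y⁆ (G.p Z) := by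
    rw [Sym2Ad.invariant, h1, ← lie_skew, map_neg]
  have h3 : a.adjustedKL.1 ⁅G.p Y, G.p Z⁆ (G.p X) = a.adjustedKL.1 ⁅G.p X, G.p Y⁆ (G.p Z) := by
    rw [h1, Sym2Ad.symm]
  simp only [ceDiff₂]
  rw [a.η_symm Y ⁅X, Z⁆, a.η_symm X ⁅Y, Z⁆, Sym2Ad.symm _ (G.p Y), Sym2Ad.symm _ (G.p X),
    LieHom.map_lie, LieHom.map_lie, LieHom.map_lie, h2, h3, ← a.η_lie X Y Z, map_neg]
  module

/-- Apply `δ` to the equation `hγ`, using `ceDiff₂_η` for the skew part of `η`. The equality of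
cocycles, finer than that of classes, is needed later to choose the gluing form `R`. -/
theorem klCocycle_eq {u : G.𝔤 →L[ℝ] G.𝔥} (hu : G.IsHalfSplitting u) {γ : 𝔣 →ₗ[ℝ] 𝔣 →ₗ[ℝ] 𝔞}
    (hγ : ∀ X Y, G.ι (γ (G.p X) (G.p Y)) =
      a.η X Y - G.omega u X Y + G.ι (a.adjustedKL.1 (G.p X) (G.p Y))) (x y z : 𝔣) :
    (G.klCocycle u hu).1 ![x, y, z] =
      a.adjustedKL.1 ⁅x, y⁆ z - ceDiff₂ (fun x y => γ x y) x y z := by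
  obtain ⟨X, rfl⟩ := G.isQuotientMap_p.surjective x
  obtain ⟨Y, rfl⟩ := G.isQuotientMap_p.surjective y
  obtain ⟨Z, rfl⟩ := G.isQuotientMap_p.surjective z
  apply G.isEmbedding_ι.injective
  rw [map_sub, CrMod.ι_ceDiff₂ hγ, CrMod.klCocycle_spec₂, ← a.ceDiff₂_η]
  simp only [ceDiff₂]
  abel

/-- The Kassel-Loday class of an adjusted crossed module is the Chern-Weil class of its adjusted
Kassel-Loday class. -/
theorem cw_adjustedKL {u : G.𝔤 →L[ℝ] G.𝔥} (hu : G.IsHalfSplitting u) :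
    cw a.adjustedKL = G.klClass u hu := by
  obtain ⟨v, hv⟩ := CrMod.exists_extension a.isSection
  have hv' := CrMod.isHalfSplitting_of_extends hv
  obtain ⟨γ, hγ, hskew, hγE⟩ := a.exists_skew_part hv
  rw [CrMod.klClass_eq hu hv']
  refine (H3.mk_eq_mk_iff (cwCocycle a.adjustedKL) _).2 ⟨γ, hγ, hskew, fun x y z => ?_⟩
  rw [a.klCocycle_eq hv' hγE]
  exact sub_sub_cancel _ _

/-- The difference `δ(p^* φ)` is skew, so the symmetric parts agree. -/
theorem Hom.adjustedKL_eq {a b : AdaptedAdjustment G} (m : Hom a b) :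
    a.adjustedKL = b.adjustedKL :=
  a.adjustedKL_unique fun X Y => by
    have h : ∀ X Y, b.η X Y - a.η X Y = -m.φ (G.p ⁅X, Y⁆) := fun X Y => by
      rw [m.η_eq, ceDiff_one]; rfl
    rw [← b.adjustedKL_spec, ← sub_eq_zero, ← smul_sub, smul_eq_zero]
    right
    have h1 := h X Y
    have h2 := h Y X
    rw [← lie_skew Y X, map_neg, map_neg, neg_neg] at h2
    have h3 : b.η X Y - a.η X Y + (b.η Y X - a.η Y X) = 0 := by rw [h1, h2, neg_add_cancel]
    rw [← neg_eq_zero, ← h3]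
    abel

end AdaptedAdjustment

/-- Both `ω_{u₂}` and `R_q` are skew, so the symmetric part of `η₂` is that of `β`. As `ω_{u₁}` is
skew too, this is the symmetric part of `η₁`. -/
theorem CrMod.Mor.IsTransport.adjustedKL_eq {G₁ G₂ : CrMod 𝔣 𝔞} {k : CrMod.Mor G₁ G₂}
    {σ : k.toButterfly.Sec} {a : AdaptedAdjustment G₁} {b : AdaptedAdjustment G₂}
    (h : k.IsTransport σ a b) : a.adjustedKL = b.adjustedKL := by
  obtain ⟨-, u₁, u₂, β, R, -, -, hβ, hR, hη⟩ := h
  have hRs : ∀ x y, R y x = -R x y := CrMod.skew_of_ι_eq hR (σ.defect_skew u₁ u₂)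
  refine (b.adjustedKL_unique fun X Y => ?_).symm
  obtain ⟨X', hX⟩ := G₁.isQuotientMap_p.surjective (G₂.p X)
  obtain ⟨Y', hY⟩ := G₁.isQuotientMap_p.surjective (G₂.p Y)
  have key : (1 / 2 : ℝ) • (β (G₂.p X) (G₂.p Y) + β (G₂.p Y) (G₂.p X)) =
      -a.adjustedKL.1 (G₂.p X) (G₂.p Y) := by
    apply G₁.isEmbedding_ι.injective
    rw [← hX, ← hY, map_smul, map_add, map_neg, ← a.adjustedKL_spec, hβ, hβ,
      CrossedModule.omega_skew X' Y']
    congr 1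
    abel
  rw [← map_neg, ← key, map_smul, map_add, hη, hη, CrossedModule.omega_skew X Y, map_sub, map_sub,
    hRs (G₂.p X), map_neg]
  congr 1
  abel

theorem AdjCrMod.Mor.adjustedKL_eq {X Y : AdjCrMod 𝔣 𝔞} (m : AdjCrMod.Mor X Y) :
    X.adj.adjustedKL = Y.adj.adjustedKL :=
  m.isTransport.adjustedKL_eq.trans m.φ.adjustedKL_eq

end FixedHomotopy

section FixedHomotopy

set_option linter.unusedSectionVars false

variable {𝔣 𝔞 : Type u} [LieRing 𝔣] [LieAlgebra ℝ 𝔣] [TopologicalSpace 𝔣] [LCLieAlgebra 𝔣]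
  [LieRing 𝔞] [LieAlgebra ℝ 𝔞] [TopologicalSpace 𝔞] [LCLieAlgebra 𝔞]

/-! ### Gluing crossed modules with cohomologous Kassel-Loday cocycles -/

namespace CrMod

section Retraction

variable {G : CrMod 𝔣 𝔞} {u : G.𝔤 →L[ℝ] G.𝔥} (hu : G.IsHalfSplitting u)

theorem exists_retraction {G : CrMod 𝔣 𝔞} {u : G.𝔤 →L[ℝ] G.𝔥} (hu : G.IsHalfSplitting u) :
    ∃ e : G.𝔥 →L[ℝ] 𝔞, ∀ y, G.ι (e y) = y - u (G.t y) := by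
  have hι := G.isEmbedding_ι.injective
  have he : ∀ y, ∃ a, G.ι a = y - u (G.t y) := fun y =>
    (G.range_ι _).2 (by rw [map_sub, hu, sub_self])
  choose e he using he
  refine ⟨⟨⟨⟨e, fun y z => hι ?_⟩, fun c y => hι ?_⟩, ?_⟩, he⟩
  · rw [map_add, he, he, he, map_add, map_add]; abel
  · change G.ι (e (c • y)) = G.ι (c • e y)
    rw [map_smul, he, he, map_smul, map_smul, smul_sub]
  · change Continuous e
    rw [G.isEmbedding_ι.continuous_iff]
    have h : G.ι ∘ e = fun y => y - u (G.t y) := funext he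
    rw [h]
    exact continuous_id.sub (u.continuous.comp G.continuous_t)

/-- The retraction `𝔥 → 𝔞` of `ι` determined by a half splitting. -/
noncomputable def retraction : G.𝔥 →L[ℝ] 𝔞 := (exists_retraction hu).choose

theorem ι_retraction (y : G.𝔥) : G.ι (retraction hu y) = y - u (G.t y) :=
  (exists_retraction hu).choose_spec y

@[simp] theorem retraction_ι (a : 𝔞) : retraction hu (G.ι a) = a :=
  G.isEmbedding_ι.injective (by rw [ι_retraction, ι_mem, map_zero, sub_zero])

/-- Because `y = u t y + ι e y`, where `e` is the retraction, equations in `𝔥` can be checked on the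
image under `t` and on the `𝔞`-component. -/
theorem eq_of_t_eq_of_retraction_eq {y z : G.𝔥} (ht : G.t y = G.t z)
    (he : retraction hu y = retraction hu z) : y = z := by
  have h := congrArg G.ι he
  rwa [ι_retraction, ι_retraction, ht, sub_left_inj] at h

/-- The continuous linear map sending `(X, a)` to the element `y` of `𝔥` with `t y = t u X` and
`𝔞`-component `a`. -/
noncomputable def lift : G.𝔤 × 𝔞 →L[ℝ] G.𝔥 :=
  u ∘L ContinuousLinearMap.fst ℝ G.𝔤 𝔞 +
    (⟨G.ι.toLinearMap, G.isEmbedding_ι.continuous⟩ : 𝔞 →L[ℝ] G.𝔥) ∘L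
      -- A half splitting need not satisfy `u t u = u`, so `u X` may itself have an `𝔞`-component,
      -- which is removed here.
      (ContinuousLinearMap.snd ℝ G.𝔤 𝔞 - retraction hu ∘L u ∘L ContinuousLinearMap.fst ℝ G.𝔤 𝔞)

theorem lift_apply (X : G.𝔤) (a : 𝔞) : lift hu (X, a) = u X + G.ι (a - retraction hu (u X)) := rfl

theorem t_lift (X : G.𝔤) (a : 𝔞) : G.t (lift hu (X, a)) = G.t (u X) := by
  rw [lift_apply, map_add, ι_mem, add_zero]

theorem retraction_lift (X : G.𝔤) (a : 𝔞) : retraction hu (lift hu (X, a)) = a := by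
  rw [lift_apply, map_add, retraction_ι, add_sub_cancel]

theorem lift_t (y : G.𝔥) : lift hu (G.t y, retraction hu y) = y :=
  eq_of_t_eq_of_retraction_eq hu (by rw [t_lift, hu]) (retraction_lift _ _ _)

end Retraction

variable (G₁ G₂ : CrMod 𝔣 𝔞)

/-- The fibre product `𝔤₁ ×_𝔣 𝔤₂`. -/
def fibreProduct : LieSubalgebra ℝ (G₁.𝔤 × G₂.𝔤) where
  carrier := {v | G₁.p v.1 = G₂.p v.2}
  add_mem' {v w} hv hw := by
    change G₁.p (v.1 + w.1) = G₂.p (v.2 + w.2)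
    rw [map_add, map_add, hv, hw]
  zero_mem' := by
    change G₁.p 0 = G₂.p 0
    rw [map_zero, map_zero]
  smul_mem' c v hv := by
    change G₁.p (c • v.1) = G₂.p (c • v.2)
    rw [map_smul, map_smul, hv]
  lie_mem' {v w} hv hw := by
    change G₁.p ⁅v.1, w.1⁆ = G₂.p ⁅v.2, w.2⁆
    rw [LieHom.map_lie, LieHom.map_lie, hv, hw]

/-- Half splittings of two crossed modules together with a primitive of the difference of their
Kassel-Loday cocycles. -/
structure Gluing where
  u₁ : G₁.𝔤 →L[ℝ] G₁.𝔥
  u₂ : G₂.𝔤 →L[ℝ] G₂.𝔥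
  hu₁ : G₁.IsHalfSplitting u₁
  hu₂ : G₂.IsHalfSplitting u₂
  R : 𝔣 →ₗ[ℝ] 𝔣 →ₗ[ℝ] 𝔞
  continuous_R : Continuous fun v : 𝔣 × 𝔣 => R v.1 v.2
  skew : ∀ x y, R y x = -R x y
  ceDiff₂_R : ∀ x y z, (G₂.klCocycle u₂ hu₂).1 ![x, y, z] - (G₁.klCocycle u₁ hu₁).1 ![x, y, z] =
    ceDiff₂ (fun x y => R x y) x y z

/-! ### The butterfly as a central extension of the fibre product. -/

namespace Gluing

variable {G₁ G₂} (D : Gluing G₁ G₂)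

/-- The projection of the fibre product to `𝔤₁`. -/
def pr₁ : fibreProduct G₁ G₂ →ₗ⁅ℝ⁆ G₁.𝔤 :=
  (LieHom.fst ℝ G₁.𝔤 G₂.𝔤).comp (fibreProduct G₁ G₂).incl

/-- The projection of the fibre product to `𝔤₂`. -/
def pr₂ : fibreProduct G₁ G₂ →ₗ⁅ℝ⁆ G₂.𝔤 :=
  (LieHom.snd ℝ G₁.𝔤 G₂.𝔤).comp (fibreProduct G₁ G₂).incl

theorem continuous_pr₁ : Continuous (pr₁ (G₁ := G₁) (G₂ := G₂)) :=
  continuous_fst.comp continuous_subtype_val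

theorem continuous_pr₂ : Continuous (pr₂ (G₁ := G₁) (G₂ := G₂)) :=
  continuous_snd.comp continuous_subtype_val

theorem p_pr (v : fibreProduct G₁ G₂) : G₁.p (pr₁ v) = G₂.p (pr₂ v) := v.2

theorem ext_pr {v w : fibreProduct G₁ G₂} (h₁ : pr₁ v = pr₁ w) (h₂ : pr₂ v = pr₂ w) : v = w :=
  Subtype.ext (Prod.ext h₁ h₂)

/-- The bilinear form on the fibre product underlying `cocycle`. -/
noncomputable def form : fibreProduct G₁ G₂ →ₗ[ℝ] fibreProduct G₁ G₂ →ₗ[ℝ] 𝔞 :=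
  ((CrossedModule.omegaBilin D.u₂).compl₁₂ pr₂.toLinearMap pr₂.toLinearMap).compr₂
      (retraction D.hu₂).toLinearMap -
    ((CrossedModule.omegaBilin D.u₁).compl₁₂ pr₁.toLinearMap pr₁.toLinearMap).compr₂
      (retraction D.hu₁).toLinearMap -
    D.R.compl₁₂ (G₁.p.toLinearMap ∘ₗ pr₁.toLinearMap) (G₁.p.toLinearMap ∘ₗ pr₁.toLinearMap)

theorem form_apply (v w : fibreProduct G₁ G₂) : D.form v w =
    retraction D.hu₂ (G₂.omega D.u₂ (pr₂ v) (pr₂ w)) -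
      retraction D.hu₁ (G₁.omega D.u₁ (pr₁ v) (pr₁ w)) - D.R (G₁.p (pr₁ v)) (G₁.p (pr₁ w)) := rfl

theorem form_skew (v w : fibreProduct G₁ G₂) : D.form w v = -D.form v w := by
  rw [form_apply, form_apply, D.skew (G₁.p (pr₁ v)), CrossedModule.omega_skew (pr₁ v),
    CrossedModule.omega_skew (pr₂ v), map_neg, map_neg]
  abel

/-- The three terms contribute the pullbacks of `C_{u₂}`, `-C_{u₁}` and `-δR`. On the fibre product
`p₁` and `p₂` agree, so these are pulled back along one map and cancel by the choice of `R`. -/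
theorem ceDiff₂_form (x y z : fibreProduct G₁ G₂) :
    ceDiff₂ (fun v w => D.form v w) x y z = 0 := by
  have h := D.ceDiff₂_R (G₁.p (pr₁ x)) (G₁.p (pr₁ y)) (G₁.p (pr₁ z))
  have h₁ := congrArg (retraction D.hu₁) (klCocycle_spec₂ D.u₁ D.hu₁ (pr₁ x) (pr₁ y) (pr₁ z))
  have h₂ := congrArg (retraction D.hu₂) (klCocycle_spec₂ D.u₂ D.hu₂ (pr₂ x) (pr₂ y) (pr₂ z))
  rw [retraction_ι] at h₁ h₂
  rw [← p_pr, ← p_pr, ← p_pr] at h₂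
  rw [h₁, h₂] at h
  simp only [ceDiff₂, map_sub, map_add, map_neg] at h
  rw [← sub_eq_zero] at h
  simp only [ceDiff₂, form_apply, LieHom.map_lie]
  rw [← h]
  abel

/-- The `2`-cocycle on the fibre product whose central extension is the butterfly. -/
noncomputable def cocycle : TwoCocycle (fibreProduct G₁ G₂) 𝔞 where
  κ := D.form
  continuous_κ := by
    have h₂ : Continuous fun v : fibreProduct G₁ G₂ × fibreProduct G₁ G₂ =>
        retraction D.hu₂ (G₂.omega D.u₂ (pr₂ v.1) (pr₂ v.2)) :=
      (retraction D.hu₂).continuous.comp (CrossedModule.continuous_omega.comp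
        ((continuous_pr₂.comp continuous_fst).prodMk (continuous_pr₂.comp continuous_snd)))
    have h₁ : Continuous fun v : fibreProduct G₁ G₂ × fibreProduct G₁ G₂ =>
        retraction D.hu₁ (G₁.omega D.u₁ (pr₁ v.1) (pr₁ v.2)) :=
      (retraction D.hu₁).continuous.comp (CrossedModule.continuous_omega.comp
        ((continuous_pr₁.comp continuous_fst).prodMk (continuous_pr₁.comp continuous_snd)))
    have hp := G₁.isQuotientMap_p.continuous
    have h₀ : Continuous fun v : fibreProduct G₁ G₂ × fibreProduct G₁ G₂ =>
        D.R (G₁.p (pr₁ v.1)) (G₁.p (pr₁ v.2)) :=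
      D.continuous_R.comp ((hp.comp (continuous_pr₁.comp continuous_fst)).prodMk
        (hp.comp (continuous_pr₁.comp continuous_snd)))
    exact (h₂.sub h₁).sub h₀
  self v := by
    have h : (2 : ℝ) • D.form v v = 0 := by
      rw [two_smul]
      nth_rewrite 2 [D.form_skew v v]
      exact add_neg_cancel _
    exact (smul_eq_zero.1 h).resolve_left two_ne_zero
  leibniz x y z := by
    have h := D.ceDiff₂_form x y z
    simp only [ceDiff₂] at h
    rw [D.form_skew y ⁅x, z⁆, D.form_skew x ⁅y, z⁆] at h
    rw [← sub_eq_zero, ← h]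
    abel

/-- The total space of the butterfly. -/
abbrev Total : Type u := CentralExt D.cocycle

/-- The inclusion of `𝔥₁`. -/
noncomputable def i₁ : G₁.𝔥 →ₗ⁅ℝ⁆ D.Total where
  -- The sign of the `𝔞`-component matches that of `ω_{u₁}` in the cocycle, as needed for a
  -- homomorphism, and yields `i₂ ι₂ = -i₁ ι₁`.
  toFun y := ⟨⟨(G₁.t y, 0), (p_t y).trans (map_zero G₂.p).symm⟩, -retraction D.hu₁ y⟩
  map_add' y z := by
    refine CentralExt.ext (ext_pr (map_add G₁.t y z) (add_zero 0).symm) ?_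
    change -retraction D.hu₁ (y + z) = -retraction D.hu₁ y + -retraction D.hu₁ z
    rw [map_add, neg_add]
  map_smul' c y := by
    refine CentralExt.ext (ext_pr (map_smul G₁.t c y) (smul_zero c).symm) ?_
    change -retraction D.hu₁ (c • y) = c • -retraction D.hu₁ y
    rw [map_smul, smul_neg]
  map_lie' {y z} := by
    refine CentralExt.ext (ext_pr (LieHom.map_lie G₁.t y z) (zero_lie (0 : G₂.𝔤)).symm) ?_
    change -retraction D.hu₁ ⁅y, z⁆ = retraction D.hu₂ (G₂.omega D.u₂ 0 0) -
      retraction D.hu₁ (G₁.omega D.u₁ (G₁.t y) (G₁.t z)) - D.R (G₁.p (G₁.t y)) (G₁.p (G₁.t z))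
    rw [← CrossedModule.omegaBilin_apply, map_zero, map_zero, p_t, p_t, map_zero,
      CrossedModule.omega_t G₁.central D.hu₁, G₁.peiffer, zero_sub, sub_zero]

/-- The inclusion of `𝔥₂`. -/
noncomputable def i₂ : G₂.𝔥 →ₗ⁅ℝ⁆ D.Total where
  toFun y := ⟨⟨(0, G₂.t y), (map_zero G₁.p).trans (p_t y).symm⟩, retraction D.hu₂ y⟩
  map_add' y z := CentralExt.ext (ext_pr (add_zero 0).symm (map_add G₂.t y z))
    (map_add (retraction D.hu₂) y z)
  map_smul' c y := CentralExt.ext (ext_pr (smul_zero c).symm (map_smul G₂.t c y))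
    (map_smul (retraction D.hu₂) c y)
  map_lie' {y z} := by
    refine CentralExt.ext (ext_pr (zero_lie (0 : G₁.𝔤)).symm (LieHom.map_lie G₂.t y z)) ?_
    change retraction D.hu₂ ⁅y, z⁆ = retraction D.hu₂ (G₂.omega D.u₂ (G₂.t y) (G₂.t z)) -
      retraction D.hu₁ (G₁.omega D.u₁ 0 0) - D.R (G₁.p 0) (G₁.p 0)
    rw [← CrossedModule.omegaBilin_apply D.u₁, map_zero, map_zero, map_zero, map_zero,
      CrossedModule.omega_t G₂.central D.hu₂, G₂.peiffer, sub_zero, sub_zero]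

/-- The projection to `𝔤₁`. -/
def r₁ : D.Total →ₗ⁅ℝ⁆ G₁.𝔤 where
  toFun Z := pr₁ Z.fst
  map_add' _ _ := rfl
  map_smul' _ _ := rfl
  map_lie' := rfl

/-- The projection to `𝔤₂`. -/
def r₂ : D.Total →ₗ⁅ℝ⁆ G₂.𝔤 where
  toFun Z := pr₂ Z.fst
  map_add' _ _ := rfl
  map_smul' _ _ := rfl
  map_lie' := rfl

theorem total_ext {Z W : D.Total} (h₁ : D.r₁ Z = D.r₁ W) (h₂ : D.r₂ Z = D.r₂ W)
    (h : Z.snd = W.snd) : Z = W :=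
  CentralExt.ext (ext_pr h₁ h₂) h

theorem p_r (Z : D.Total) : G₁.p (D.r₁ Z) = G₂.p (D.r₂ Z) := p_pr Z.fst

theorem snd_lie (Z W : D.Total) : ⁅Z, W⁆.snd =
    retraction D.hu₂ (G₂.omega D.u₂ (D.r₂ Z) (D.r₂ W)) -
      retraction D.hu₁ (G₁.omega D.u₁ (D.r₁ Z) (D.r₁ W)) -
        D.R (G₁.p (D.r₁ Z)) (G₁.p (D.r₁ W)) := rfl

theorem continuous_mk {S : Type*} [TopologicalSpace S] {f : S → G₁.𝔤} {g : S → G₂.𝔤} {h : S → 𝔞}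
    (hfg : ∀ x, G₁.p (f x) = G₂.p (g x)) (hf : Continuous f) (hg : Continuous g)
    (hh : Continuous h) :
    Continuous fun x => (⟨⟨(f x, g x), hfg x⟩, h x⟩ : D.Total) :=
  CentralExt.continuous_mk ((hf.prodMk hg).subtype_mk hfg) hh

theorem continuous_r₁ : Continuous D.r₁ := continuous_pr₁.comp CentralExt.continuous_fst

theorem continuous_r₂ : Continuous D.r₂ := continuous_pr₂.comp CentralExt.continuous_fst

/-- A continuous linear map into the total space. -/
def mkL {V : Type*} [AddCommGroup V] [Module ℝ V] [TopologicalSpace V] (f : V →L[ℝ] G₁.𝔤)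
    (g : V →L[ℝ] G₂.𝔤) (hfg : ∀ x, G₁.p (f x) = G₂.p (g x)) : V →L[ℝ] D.Total where
  toFun x := ⟨⟨(f x, g x), hfg x⟩, 0⟩
  map_add' x y := CentralExt.ext (ext_pr (map_add f x y) (map_add g x y)) (add_zero 0).symm
  map_smul' c x := CentralExt.ext (ext_pr (map_smul f c x) (map_smul g c x)) (smul_zero c).symm
  cont := D.continuous_mk hfg f.continuous g.continuous continuous_const

/-- The left inverse of `i₁`. -/
noncomputable def j₁ : D.Total →L[ℝ] G₁.𝔥 where
  toFun Z := lift D.hu₁ (D.r₁ Z, -Z.snd)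
  map_add' Z W := by
    rw [← map_add, Prod.mk_add_mk, ← map_add, ← neg_add]; rfl
  map_smul' c Z := by
    rw [RingHom.id_apply, ← map_smul, Prod.smul_mk, ← map_smul, smul_neg]; rfl
  cont := (lift D.hu₁).continuous.comp (D.continuous_r₁.prodMk CentralExt.continuous_snd.neg)

/-- The left inverse of `i₂`. -/
noncomputable def j₂ : D.Total →L[ℝ] G₂.𝔥 where
  toFun Z := lift D.hu₂ (D.r₂ Z, Z.snd)
  map_add' Z W := by
    rw [← map_add, Prod.mk_add_mk, ← map_add]; rfl
  map_smul' c Z := by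
    rw [RingHom.id_apply, ← map_smul, Prod.smul_mk, ← map_smul]; rfl
  cont := (lift D.hu₂).continuous.comp (D.continuous_r₂.prodMk CentralExt.continuous_snd)

theorem j₁_apply (Z : D.Total) : D.j₁ Z = lift D.hu₁ (D.r₁ Z, -Z.snd) := rfl

theorem j₂_apply (Z : D.Total) : D.j₂ Z = lift D.hu₂ (D.r₂ Z, Z.snd) := rfl

theorem i₁_α (Z : D.Total) (y : G₁.𝔥) : D.i₁ (G₁.α (D.r₁ Z) y) = ⁅Z, D.i₁ y⁆ := by
  refine D.total_ext ?_ ?_ ?_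
  · rw [LieHom.map_lie]
    exact G₁.equivariant _ _
  · rw [LieHom.map_lie]
    exact (lie_zero _).symm
  · rw [snd_lie]
    change -retraction D.hu₁ (G₁.α (D.r₁ Z) y) = retraction D.hu₂ (G₂.omega D.u₂ (D.r₂ Z) 0) -
      retraction D.hu₁ (G₁.omega D.u₁ (D.r₁ Z) (G₁.t y)) - D.R (G₁.p (D.r₁ Z)) (G₁.p (G₁.t y))
    rw [← CrossedModule.omegaBilin_apply, map_zero, map_zero, p_t, map_zero,
      CrossedModule.omega_t G₁.central D.hu₁, zero_sub, sub_zero]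

theorem i₂_α (Z : D.Total) (y : G₂.𝔥) : D.i₂ (G₂.α (D.r₂ Z) y) = ⁅Z, D.i₂ y⁆ := by
  refine D.total_ext ?_ ?_ ?_
  · rw [LieHom.map_lie]
    exact (lie_zero _).symm
  · rw [LieHom.map_lie]
    exact G₂.equivariant _ _
  · rw [snd_lie]
    change retraction D.hu₂ (G₂.α (D.r₂ Z) y) =
      retraction D.hu₂ (G₂.omega D.u₂ (D.r₂ Z) (G₂.t y)) -
      retraction D.hu₁ (G₁.omega D.u₁ (D.r₁ Z) 0) - D.R (G₁.p (D.r₁ Z)) (G₁.p 0)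
    rw [← CrossedModule.omegaBilin_apply D.u₁, map_zero, map_zero, map_zero, map_zero,
      CrossedModule.omega_t G₂.central D.hu₂, sub_zero, sub_zero]

/-- `p` as a continuous linear map. -/
def pL (G : CrMod 𝔣 𝔞) : G.𝔤 →L[ℝ] 𝔣 := ⟨G.p.toLinearMap, G.isQuotientMap_p.continuous⟩

section Sections

variable {s₁ : 𝔣 →L[ℝ] G₁.𝔤} {s₂ : 𝔣 →L[ℝ] G₂.𝔤} (hs₁ : G₁.IsSection s₁) (hs₂ : G₂.IsSection s₂)

/-- The section `X ↦ (X, s₂ p₁ X, 0)` of `r₁`. -/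
def q₁ : G₁.𝔤 →L[ℝ] D.Total :=
  D.mkL (ContinuousLinearMap.id ℝ G₁.𝔤) (s₂ ∘L pL G₁) fun X => (hs₂ (G₁.p X)).symm

/-- The section `X ↦ (s₁ p₂ X, X, 0)` of `r₂`. -/
def q₂ : G₂.𝔤 →L[ℝ] D.Total :=
  D.mkL (s₁ ∘L pL G₂) (ContinuousLinearMap.id ℝ G₂.𝔤) fun X => hs₁ (G₂.p X)

theorem i₁_j₁ (h : ∀ X, s₁ (G₁.p X) = X - G₁.t (D.u₁ X)) (Z : D.Total) :
    D.i₁ (D.j₁ Z) + D.q₂ hs₁ (D.r₂ Z) = Z := by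
  refine D.total_ext ?_ ?_ ?_
  · change G₁.t (D.j₁ Z) + s₁ (G₂.p (D.r₂ Z)) = _
    rw [j₁_apply, t_lift, ← p_r, h, add_sub_cancel]
  · exact zero_add _
  · change -retraction D.hu₁ (D.j₁ Z) + 0 = _
    rw [j₁_apply, retraction_lift, neg_neg, add_zero]

theorem i₂_j₂ (h : ∀ X, s₂ (G₂.p X) = X - G₂.t (D.u₂ X)) (Z : D.Total) :
    D.i₂ (D.j₂ Z) + D.q₁ hs₂ (D.r₁ Z) = Z := by
  refine D.total_ext ?_ ?_ ?_
  · exact zero_add _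
  · change G₂.t (D.j₂ Z) + s₂ (G₁.p (D.r₁ Z)) = _
    rw [j₂_apply, t_lift, p_r, h, add_sub_cancel]
  · change retraction D.hu₂ (D.j₂ Z) + 0 = _
    rw [j₂_apply, retraction_lift, add_zero]

end Sections

/-- The invertible butterfly determined by a gluing. -/
noncomputable def mor : CrMod.Mor G₁ G₂ where
  𝔨 := D.Total
  i₁ := D.i₁
  i₂ := D.i₂
  r₁ := D.r₁
  r₂ := D.r₂
  continuous_i₁ := D.continuous_mk _ G₁.continuous_t continuous_const
    (retraction D.hu₁).continuous.neg
  continuous_i₂ := D.continuous_mk _ continuous_const G₂.continuous_t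
    (retraction D.hu₂).continuous
  continuous_r₁ := D.continuous_r₁
  continuous_r₂ := D.continuous_r₂
  r₁_i₁ _ := rfl
  r₂_i₂ _ := rfl
  r₂_i₁ _ := rfl
  exact := by
    obtain ⟨s₂, hs₂, h₂⟩ := exists_section D.hu₂
    exact ⟨fun _ => rfl, D.q₁ hs₂, D.j₂, fun _ => rfl, fun y => lift_t D.hu₂ y, D.i₂_j₂ hs₂ h₂⟩
  i₁_α := D.i₁_α
  i₂_α := D.i₂_α
  invertible := by
    obtain ⟨s₁, hs₁, h₁⟩ := exists_section D.hu₁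
    refine ⟨fun _ => rfl, D.q₂ hs₁, D.j₁, fun _ => rfl, fun y => ?_, D.i₁_j₁ hs₁ h₁⟩
    change lift D.hu₁ (G₁.t y, - -retraction D.hu₁ y) = y
    rw [neg_neg, lift_t]
  π₀_eq Z := (D.p_r Z).symm
  π₁_eq a := by
    refine D.total_ext ?_ ?_ ?_
    · change 0 = -G₁.t (G₁.ι a)
      rw [ι_mem, neg_zero]
    · change G₂.t (G₂.ι a) = -0
      rw [ι_mem, neg_zero]
    · change retraction D.hu₂ (G₂.ι a) = - -retraction D.hu₁ (G₁.ι a)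
      rw [retraction_ι, retraction_ι, neg_neg]

/-- The section `X ↦ (X, s₂ p₁ X, 0)` of the butterfly. -/
noncomputable def sec {s₂ : 𝔣 →L[ℝ] G₂.𝔤} (hs₂ : G₂.IsSection s₂)
    (h₂ : ∀ X, s₂ (G₂.p X) = X - G₂.t (D.u₂ X)) : D.mor.toButterfly.Sec where
  q := D.q₁ hs₂
  j := D.j₂
  r₁_q _ := rfl
  i₂_j := D.i₂_j₂ hs₂ h₂

section SecLemmas

variable {s₂ : 𝔣 →L[ℝ] G₂.𝔤} (hs₂ : G₂.IsSection s₂) (h₂ : ∀ X, s₂ (G₂.p X) = X - G₂.t (D.u₂ X))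

theorem sec_φ (X : G₁.𝔤) : (D.sec hs₂ h₂).φ X = s₂ (G₁.p X) := rfl

theorem sec_f (y : G₁.𝔥) : (D.sec hs₂ h₂).f y = G₂.ι (retraction D.hu₁ y) := by
  change -lift D.hu₂ (0, -retraction D.hu₁ y) = _
  rw [lift_apply, map_zero, map_zero, zero_add, sub_zero, map_neg, neg_neg]

theorem retraction_sec_lam (X Y : G₁.𝔤) : retraction D.hu₂ ((D.sec hs₂ h₂).lam X Y) =
    retraction D.hu₂ (G₂.omega D.u₂ (s₂ (G₁.p X)) (s₂ (G₁.p Y))) -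
      retraction D.hu₁ (G₁.omega D.u₁ X Y) - D.R (G₁.p X) (G₁.p Y) :=
  retraction_lift D.hu₂ _ _

/-- The cocycle of the extension was built so that the defect of its natural section is the
prescribed `R`, not merely a cohomologous form. Both components can be read off: `t` of the right
side vanishes, and in the `𝔞`-component the `ω` terms cancel against those in `λ`. -/
theorem ι_R (X Y : G₁.𝔤) : G₂.ι (D.R (G₁.p X) (G₁.p Y)) =
    G₂.omega D.u₂ ((D.sec hs₂ h₂).φ X) ((D.sec hs₂ h₂).φ Y) -
      (D.sec hs₂ h₂).f (G₁.omega D.u₁ X Y) - (D.sec hs₂ h₂).lam X Y := by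
  refine eq_of_t_eq_of_retraction_eq D.hu₂ ?_ ?_
  · have h : ∀ W, G₂.t (D.u₂ W) = W - s₂ (G₂.p W) := fun W => by rw [h₂]; abel
    rw [map_sub, map_sub, ι_mem, CrossedModule.t_omega D.hu₂, h, sec_f, ι_mem,
      Butterfly.Sec.t_lam, sec_φ, sec_φ, sec_φ, LieHom.map_lie, LieHom.map_lie, hs₂, hs₂]
    abel
  · rw [map_sub, map_sub, retraction_ι, sec_f, retraction_ι, retraction_sec_lam, sec_φ, sec_φ]
    abel

end SecLemmas

end Gluing

/-- Crossed modules with the same Kassel-Loday class are related by an invertible butterfly. -/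
theorem nonempty_mor_of_klClass_eq {G₁ G₂ : CrMod 𝔣 𝔞} {u₁ : G₁.𝔤 →L[ℝ] G₁.𝔥}
    {u₂ : G₂.𝔤 →L[ℝ] G₂.𝔥} (hu₁ : G₁.IsHalfSplitting u₁) (hu₂ : G₂.IsHalfSplitting u₂)
    (h : G₁.klClass u₁ hu₁ = G₂.klClass u₂ hu₂) : Nonempty (CrMod.Mor G₁ G₂) := by
  obtain ⟨R, hR, hskew, hd⟩ := (H3.mk_eq_mk_iff _ _).1 h.symm
  exact ⟨(⟨u₁, u₂, hu₁, hu₂, R, hR, hskew, hd⟩ : Gluing G₁ G₂).mor⟩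

end CrMod

/-- Adjusted crossed modules with the same adjusted Kassel-Loday class are isomorphic. -/
theorem AdjCrMod.nonempty_mor_of_adjustedKL_eq {X Y : AdjCrMod 𝔣 𝔞}
    (h : X.adj.adjustedKL = Y.adj.adjustedKL) : Nonempty (AdjCrMod.Mor X Y) := by
  obtain ⟨u₁, hu₁⟩ := CrMod.exists_extension X.adj.isSection
  obtain ⟨u₂, hu₂⟩ := CrMod.exists_extension Y.adj.isSection
  have hu₁' := CrMod.isHalfSplitting_of_extends hu₁
  have hu₂' := CrMod.isHalfSplitting_of_extends hu₂
  obtain ⟨γ₁, hγ₁, hskew₁, hγE₁⟩ := X.adj.exists_skew_part hu₁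
  obtain ⟨γ₂, hγ₂, hskew₂, hγE₂⟩ := Y.adj.exists_skew_part hu₂
  let D : CrMod.Gluing X.G Y.G :=
    { u₁ := u₁
      u₂ := u₂
      hu₁ := hu₁'
      hu₂ := hu₂'
      -- Each Kassel-Loday cocycle is the Chern-Weil cocycle of the common `B` minus `δγᵢ`, so their
      -- difference is `δ(γ₁ - γ₂)`.
      R := γ₁ - γ₂
      continuous_R := hγ₁.sub hγ₂
      skew := fun x y => by
        simp only [LinearMap.sub_apply]
        rw [hskew₁, hskew₂]; abel
      ceDiff₂_R := fun x y z => by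
        rw [X.adj.klCocycle_eq hu₁' hγE₁, Y.adj.klCocycle_eq hu₂' hγE₂, h]
        simp only [ceDiff₂, LinearMap.sub_apply]
        abel }
  have h₂ : ∀ W, Y.adj.s (Y.G.p W) = W - Y.G.t (D.u₂ W) := fun W => by
    change _ = W - Y.G.t (u₂ W)
    rw [hu₂]; abel
  -- With `β = γ₁ - B` and `R = γ₁ - γ₂` one gets `β - R = γ₂ - B`, so the transported adjustment is
  -- already that of `Y`, and `φ = 0` completes the morphism.
  refine ⟨⟨D.mor, D.sec Y.adj.isSection h₂, Y.adj, ⟨fun x => ?_, u₁, u₂,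
    fun x y => γ₁ x y - X.adj.adjustedKL.1 x y, fun x y => D.R x y, hu₁, hu₂, fun V W => ?_,
    D.ι_R Y.adj.isSection h₂, fun V W => ?_⟩, ⟨0, fun x => ?_, fun V W => ?_⟩⟩⟩
  · rw [D.sec_φ, X.adj.isSection]
  · rw [map_sub, hγE₁]; abel
  · change _ = _ + Y.G.ι (γ₁ _ _ - X.adj.adjustedKL.1 _ _ - (γ₁ _ _ - γ₂ _ _))
    rw [sub_sub_sub_cancel_left, map_sub, hγE₂, h]
    abel
  · simp
  · rw [ceDiff_one]; simp

end FixedHomotopy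

/-! ### Continuity of bilinear maps through seminorms -/

section Seminorms

open Topology

theorem exists_seminorm_ball_subset {E : Type*} [AddCommGroup E] [Module ℝ E] [TopologicalSpace E]
    [IsTopologicalAddGroup E] [ContinuousSMul ℝ E] [LocallyConvexSpace ℝ E] {U : Set E}
    (hU : U ∈ 𝓝 (0 : E)) : ∃ p : Seminorm ℝ E, Continuous p ∧ p.ball 0 1 ⊆ U := by
  obtain ⟨s, hs, hsU⟩ := (nhds_hasBasis_absConvex_open ℝ E).mem_iff.1 hU
  refine ⟨gaugeSeminormFamily ℝ E ⟨s, hs⟩, with_gaugeSeminormFamily.continuous_seminorm _, ?_⟩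
  exact (gaugeSeminormFamily_ball _).trans_subset hsU

/-- Continuity at the origin bounds `β` on a product of seminorm balls; homogeneity in each variable
spreads this to a product bound. Such bounds can be made uniform over the degrees of polynomials. -/
theorem exists_seminorm_bilin_le {E F V : Type*}
    [AddCommGroup E] [Module ℝ E] [TopologicalSpace E] [IsTopologicalAddGroup E]
    [ContinuousSMul ℝ E] [LocallyConvexSpace ℝ E]
    [AddCommGroup F] [Module ℝ F] [TopologicalSpace F] [IsTopologicalAddGroup F]
    [ContinuousSMul ℝ F] [LocallyConvexSpace ℝ F]
    [AddCommGroup V] [Module ℝ V] [TopologicalSpace V]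
    (β : E →ₗ[ℝ] F →ₗ[ℝ] V) (hβ : Continuous fun v : E × F => β v.1 v.2)
    {r : Seminorm ℝ V} (hr : Continuous r) :
    ∃ (p : Seminorm ℝ E) (q : Seminorm ℝ F), Continuous p ∧ Continuous q ∧
      ∀ x y, r (β x y) ≤ p x * q y := by
  have h0 : {v : E × F | r (β v.1 v.2) < 1} ∈ 𝓝 ((0 : E), (0 : F)) := by
    refine (hr.comp hβ).continuousAt.eventually_lt continuousAt_const ?_
    simp
  rw [nhds_prod_eq, Filter.mem_prod_iff] at h0
  obtain ⟨U, hU, W, hW, hUW⟩ := h0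
  obtain ⟨p, hp, hpU⟩ := exists_seminorm_ball_subset hU
  obtain ⟨q, hq, hqW⟩ := exists_seminorm_ball_subset hW
  have key : ∀ x y, p x < 1 → q y < 1 → r (β x y) ≤ 1 := fun x y hx hy =>
    (hUW (Set.mk_mem_prod (hpU (by simpa using hx)) (hqW (by simpa using hy)))).le
  refine ⟨p, q, hp, hq, fun x y => ?_⟩
  -- The shift by `ε` allows the rescaling when `p x` or `q y` is zero; it is removed by a limit.
  have hε : ∀ ε : ℝ, 0 < ε → r (β x y) ≤ (p x + ε) * (q y + ε) := fun ε hε => by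
    have ha : 0 < p x + ε := add_pos_of_nonneg_of_pos (apply_nonneg p x) hε
    have hb : 0 < q y + ε := add_pos_of_nonneg_of_pos (apply_nonneg q y) hε
    have h := key ((p x + ε)⁻¹ • x) ((q y + ε)⁻¹ • y)
      (by
        rw [map_smul_eq_mul, norm_inv, Real.norm_of_nonneg ha.le, inv_mul_lt_one₀ ha]
        linarith)
      (by
        rw [map_smul_eq_mul, norm_inv, Real.norm_of_nonneg hb.le, inv_mul_lt_one₀ hb]
        linarith)
    rw [(β _).map_smul, β.map_smul, LinearMap.smul_apply, map_smul_eq_mul, map_smul_eq_mul,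
      norm_inv,
      norm_inv, Real.norm_of_nonneg ha.le, Real.norm_of_nonneg hb.le, ← mul_assoc, ← mul_inv,
      inv_mul_le_one₀ (mul_pos hb ha)] at h
    rwa [mul_comm (q y + ε)] at h
  have ht : Filter.Tendsto (fun ε : ℝ => (p x + ε) * (q y + ε)) (𝓝[>] 0)
      (𝓝 ((p x + 0) * (q y + 0))) :=
    (Continuous.tendsto (by fun_prop) 0).mono_left nhdsWithin_le_nhds
  rw [add_zero, add_zero] at ht
  exact ge_of_tendsto ht (Filter.eventually_of_mem self_mem_nhdsWithin hε)

/-- The increment at `(a, b)` splits as `β(x - a, y) + β(a, y - b)`, and the bound for each summand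
tends to zero. -/
theorem continuous_bilin_of_seminorm_le {E F V ι : Type*}
    [AddCommGroup E] [Module ℝ E] [TopologicalSpace E] [IsTopologicalAddGroup E]
    [AddCommGroup F] [Module ℝ F] [TopologicalSpace F] [IsTopologicalAddGroup F]
    [AddCommGroup V] [Module ℝ V] [TopologicalSpace V]
    {r : SeminormFamily ℝ V ι} (hr : WithSeminorms r) (β : E →ₗ[ℝ] F →ₗ[ℝ] V)
    (h : ∀ i, ∃ (C : ℝ) (p : Seminorm ℝ E) (q : Seminorm ℝ F), Continuous p ∧ Continuous q ∧
      ∀ x y, r i (β x y) ≤ C * (p x * q y)) : Continuous fun v : E × F => β v.1 v.2 := by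
  rw [continuous_iff_continuousAt]
  rintro ⟨a, b⟩
  refine (hr.tendsto_nhds _ _).2 fun i ε hε => ?_
  obtain ⟨C, p, q, hp, hq, hC⟩ := h i
  have ht : Continuous fun v : E × F =>
      C * (p (v.1 - a) * q v.2) + C * (p a * q (v.2 - b)) := by fun_prop
  have hlt : ∀ᶠ v in 𝓝 (a, b), C * (p (v.1 - a) * q v.2) + C * (p a * q (v.2 - b)) < ε :=
    ht.continuousAt.eventually_lt continuousAt_const (by simpa using hε)
  filter_upwards [hlt] with v hv
  have e : β v.1 v.2 - β a b = β (v.1 - a) v.2 + β a (v.2 - b) := by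
    rw [map_sub, map_sub, LinearMap.sub_apply]; abel
  rw [e]
  exact ((map_add_le_add (r i) _ _).trans (add_le_add (hC _ _) (hC _ _))).trans_lt hv

end Seminorms

/-! ### Polynomial loops vanishing at the origin -/

/-- The space `x 𝔣[x]` of polynomials without constant term and with coefficients in `𝔣`. -/
def Poly (𝔣 : Type*) [AddCommGroup 𝔣] : Type _ := ℕ+ →₀ 𝔣

namespace Poly

section LinearAlgebra

variable {𝔣 V : Type*} [AddCommGroup 𝔣] [Module ℝ 𝔣] [AddCommGroup V] [Module ℝ V]

noncomputable instance : AddCommGroup (Poly 𝔣) := inferInstanceAs (AddCommGroup (ℕ+ →₀ 𝔣))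

noncomputable instance : Module ℝ (Poly 𝔣) := inferInstanceAs (Module ℝ (ℕ+ →₀ 𝔣))

/-- The monomial `a xⁿ`. -/
noncomputable def monomial (n : ℕ+) : 𝔣 →ₗ[ℝ] Poly 𝔣 := Finsupp.lsingle n

/-- The coefficient of `xⁿ`. -/
noncomputable def coeff (n : ℕ+) : Poly 𝔣 →ₗ[ℝ] 𝔣 := Finsupp.lapply n

/-- The linear map determined by its values on monomials. -/
noncomputable def lift (F : ℕ+ → 𝔣 →ₗ[ℝ] V) : Poly 𝔣 →ₗ[ℝ] V := Finsupp.lsum ℝ F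

@[simp] theorem lift_monomial (F : ℕ+ → 𝔣 →ₗ[ℝ] V) (n : ℕ+) (x : 𝔣) :
    lift F (monomial n x) = F n x :=
  Finsupp.lsum_single ℝ F n x

theorem induction {P : Poly 𝔣 → Prop} (X : Poly 𝔣) (h0 : P 0)
    (hadd : ∀ X Y, P X → P Y → P (X + Y)) (hmon : ∀ n x, P (monomial n x)) : P X :=
  Finsupp.induction_linear (M := 𝔣) X h0 hadd hmon

/-- The bilinear map determined by its values on monomials. -/
noncomputable def lift₂ (F : ℕ+ → ℕ+ → 𝔣 →ₗ[ℝ] 𝔣 →ₗ[ℝ] V) : Poly 𝔣 →ₗ[ℝ] Poly 𝔣 →ₗ[ℝ] V :=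
  lift fun n => (lift fun m => (F n m).flip).flip

@[simp] theorem lift₂_monomial (F : ℕ+ → ℕ+ → 𝔣 →ₗ[ℝ] 𝔣 →ₗ[ℝ] V) (n m : ℕ+) (x y : 𝔣) :
    lift₂ F (monomial n x) (monomial m y) = F n m x y := by
  rw [lift₂, lift_monomial, LinearMap.flip_apply, lift_monomial, LinearMap.flip_apply]

theorem induction₂ {P : Poly 𝔣 → Poly 𝔣 → Prop} (X Y : Poly 𝔣) (h0 : ∀ X, P X 0)
    (h0' : ∀ Y, P 0 Y) (hl : ∀ X X' Y, P X Y → P X' Y → P (X + X') Y)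
    (hr : ∀ X Y Y', P X Y → P X Y' → P X (Y + Y'))
    (hmon : ∀ n x m y, P (monomial n x) (monomial m y)) : P X Y :=
  induction X (h0' Y) (fun X X' h h' => hl X X' Y h h') fun n x =>
    induction Y (h0 _) (fun _ _ h h' => hr _ _ _ h h') fun m y => hmon n x m y

/-- The seminorm `∑ₙ q(aₙ)` of the polynomial `∑ₙ aₙ xⁿ`. -/
noncomputable def sumSeminorm (q : Seminorm ℝ 𝔣) : Seminorm ℝ (Poly 𝔣) :=
  Seminorm.of (fun X => Finsupp.sum (M := 𝔣) X fun _ x => q x)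
    (fun X Y => by
      classical
      let X' : ℕ+ →₀ 𝔣 := X
      let Y' : ℕ+ →₀ 𝔣 := Y
      change (X' + Y').sum (fun _ x => q x) ≤ X'.sum (fun _ x => q x) + Y'.sum (fun _ x => q x)
      rw [Finsupp.sum_of_support_subset X' Finset.subset_union_left _ (by simp),
        Finsupp.sum_of_support_subset Y' (Finset.subset_union_right (s₁ := X'.support)) _ (by simp),
        Finsupp.sum_of_support_subset (X' + Y') Finsupp.support_add _ (by simp),
        ← Finset.sum_add_distrib]
      exact Finset.sum_le_sum fun n _ => map_add_le_add q _ _)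
    (fun c X => by
      let X' : ℕ+ →₀ 𝔣 := X
      change (c • X').sum (fun _ x => q x) = ‖c‖ * X'.sum (fun _ x => q x)
      rw [Finsupp.sum_of_support_subset (c • X') Finsupp.support_smul _ (by simp), Finsupp.sum,
        Finset.mul_sum]
      exact Finset.sum_congr rfl fun n _ => map_smul_eq_mul q _ _)

@[simp] theorem sumSeminorm_monomial (q : Seminorm ℝ 𝔣) (n : ℕ+) (x : 𝔣) :
    sumSeminorm q (monomial n x) = q x :=
  Finsupp.sum_single_index (map_zero q)

theorem lift_seminorm_le (r : Seminorm ℝ V) (F : ℕ+ → 𝔣 →ₗ[ℝ] V) (q : Seminorm ℝ 𝔣) (C : ℝ)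
    (h : ∀ n x, r (F n x) ≤ C * q x) (X : Poly 𝔣) : r (lift F X) ≤ C * sumSeminorm q X := by
  let X' : ℕ+ →₀ 𝔣 := X
  change r (∑ n ∈ X'.support, F n (X' n)) ≤ C * ∑ n ∈ X'.support, q (X' n)
  rw [Finset.mul_sum]
  exact (Finset.le_sum_of_subadditive r (map_zero r).le (map_add_le_add r) _ _).trans (Finset.sum_le_sum fun n _ => h n _)

/-- The constant and the seminorms must not depend on the degrees `n`, `m`. The bound for sums then
follows by applying `lift_seminorm_le` in each variable. -/
theorem lift₂_seminorm_le (r : Seminorm ℝ V) (F : ℕ+ → ℕ+ → 𝔣 →ₗ[ℝ] 𝔣 →ₗ[ℝ] V)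
    (p q : Seminorm ℝ 𝔣) (C : ℝ) (h : ∀ n m x y, r (F n m x y) ≤ C * (p x * q y))
    (X Y : Poly 𝔣) : r (lift₂ F X Y) ≤ C * (sumSeminorm p X * sumSeminorm q Y) := by
  have h1 : ∀ n x, r ((lift fun m => (F n m).flip).flip x Y) ≤ C * sumSeminorm q Y * p x :=
    fun n x => by
      have e : (lift fun m => (F n m).flip).flip x Y = lift (fun m => F n m x) Y :=
        induction (P := fun Y => (lift fun m => (F n m).flip).flip x Y = lift (fun m => F n m x) Y)
          Y (by simp) (fun _ _ h h' => by rw [map_add, map_add, h, h']) (by simp)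
      rw [e]
      refine (lift_seminorm_le r _ q (C * p x) (fun m y => ?_) Y).trans_eq (by ring)
      rw [mul_assoc]
      exact h n m x y
  have e : lift₂ F X Y = lift (fun n => ((lift fun m => (F n m).flip).flip).flip Y) X :=
    induction (P := fun X => lift₂ F X Y =
      lift (fun n => ((lift fun m => (F n m).flip).flip).flip Y) X)
      X (by simp) (fun _ _ h h' => by rw [map_add, map_add, LinearMap.add_apply, h, h'])
      (by simp [lift₂])
  rw [e]
  refine (lift_seminorm_le r _ p (C * sumSeminorm q Y) (fun n x => h1 n x) X).trans_eq (by ring)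

end LinearAlgebra

section LieAlgebra

variable {𝔣 : Type*} [LieRing 𝔣] [LieAlgebra ℝ 𝔣]

/-- The bracket of polynomials. -/
noncomputable def bracket : Poly 𝔣 →ₗ[ℝ] Poly 𝔣 →ₗ[ℝ] Poly 𝔣 :=
  lift₂ fun n m => (lieBilin 𝔣).compr₂ (monomial (n + m))

theorem bracket_monomial (n m : ℕ+) (x y : 𝔣) :
    bracket (monomial n x) (monomial m y) = monomial (n + m) ⁅x, y⁆ := by
  rw [bracket, lift₂_monomial]; rfl

theorem bracket_skew (X Y : Poly 𝔣) : bracket Y X = -bracket X Y := by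
  refine induction₂ (P := fun X Y => bracket Y X = -bracket X Y) X Y (by simp) (by simp)
    (fun X X' Y h h' => ?_) (fun X Y Y' h h' => ?_) fun n x m y => ?_
  · simp only [map_add, LinearMap.add_apply, h, h', neg_add]
  · simp only [map_add, LinearMap.add_apply, h, h', neg_add]
  · rw [bracket_monomial, bracket_monomial, ← lie_skew, map_neg, add_comm]

theorem bracket_leibniz (X Y Z : Poly 𝔣) :
    bracket X (bracket Y Z) = bracket (bracket X Y) Z + bracket Y (bracket X Z) := by
  refine induction₂ (P := fun X Y => bracket X (bracket Y Z) =
    bracket (bracket X Y) Z + bracket Y (bracket X Z)) X Y (by simp) (by simp)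
    (fun X X' Y h h' => ?_) (fun X Y Y' h h' => ?_) fun n x m y => ?_
  · simp only [map_add, LinearMap.add_apply, h, h']; abel
  · simp only [map_add, LinearMap.add_apply, h, h']; abel
  · refine induction (P := fun Z => bracket (monomial n x) (bracket (monomial m y) Z) =
      bracket (bracket (monomial n x) (monomial m y)) Z +
        bracket (monomial m y) (bracket (monomial n x) Z)) Z (by simp) (fun Z Z' h h' => ?_)
      fun k z => ?_
    · simp only [map_add, h, h']; abel
    · simp only [bracket_monomial]
      rw [leibniz_lie, map_add, add_assoc, add_left_comm m n k]

noncomputable instance : LieRing (Poly 𝔣) where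
  bracket X Y := bracket X Y
  add_lie X Y Z := by
    change bracket (X + Y) Z = bracket X Z + bracket Y Z
    rw [map_add, LinearMap.add_apply]
  lie_add X Y Z := map_add (bracket X) Y Z
  lie_self X := by
    change bracket X X = 0
    have h : (2 : ℝ) • bracket X X = 0 := by
      rw [two_smul]
      nth_rewrite 2 [bracket_skew X X]
      exact add_neg_cancel _
    exact (smul_eq_zero.1 h).resolve_left two_ne_zero
  leibniz_lie := bracket_leibniz

@[simp] theorem lie_monomial (n m : ℕ+) (x y : 𝔣) :
    ⁅monomial n x, monomial m y⁆ = monomial (n + m) ⁅x, y⁆ := bracket_monomial n m x y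

noncomputable instance : LieAlgebra ℝ (Poly 𝔣) where
  lie_smul c X Y := map_smul (bracket X) c Y

/-- Evaluation of polynomials at `1`. -/
noncomputable def eval : Poly 𝔣 →ₗ⁅ℝ⁆ 𝔣 where
  __ := lift fun _ => LinearMap.id
  map_lie' {X Y} := by
    let f : Poly 𝔣 →ₗ[ℝ] 𝔣 := lift fun _ => LinearMap.id
    change f ⁅X, Y⁆ = ⁅f X, f Y⁆
    refine induction₂ (P := fun X Y => f ⁅X, Y⁆ = ⁅f X, f Y⁆) X Y (by simp) (by simp)
      (fun X X' Y h h' => ?_) (fun X Y Y' h h' => ?_) fun n x m y => ?_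
    · rw [add_lie, map_add, map_add, add_lie, h, h']
    · rw [lie_add, map_add, map_add, lie_add, h, h']
    · simp [f]

theorem eval_apply (X : Poly 𝔣) : eval X = lift (fun _ => LinearMap.id) X := rfl

@[simp] theorem eval_monomial (n : ℕ+) (x : 𝔣) : eval (monomial n x) = x := by
  rw [eval_apply, lift_monomial, LinearMap.id_apply]

end LieAlgebra

/-! ### The locally convex topology on polynomials. -/

section Topology

set_option linter.unusedSectionVars false

/-- The family of seminorms `∑ₙ q(aₙ)`, where `q` is a continuous seminorm of `𝔣`. -/
noncomputable def seminormFamily (𝔣 : Type*) [AddCommGroup 𝔣] [Module ℝ 𝔣] [TopologicalSpace 𝔣] :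
    SeminormFamily ℝ (Poly 𝔣) {q : Seminorm ℝ 𝔣 // Continuous q} :=
  fun q => sumSeminorm q.1

variable {𝔣 : Type u}

noncomputable instance [AddCommGroup 𝔣] [Module ℝ 𝔣] [TopologicalSpace 𝔣] :
    TopologicalSpace (Poly 𝔣) :=
  (seminormFamily 𝔣).moduleFilterBasis.topology

theorem withSeminorms [AddCommGroup 𝔣] [Module ℝ 𝔣] [TopologicalSpace 𝔣] :
    WithSeminorms (seminormFamily 𝔣) := ⟨rfl⟩

theorem continuous_sumSeminorm [AddCommGroup 𝔣] [Module ℝ 𝔣] [TopologicalSpace 𝔣]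
    {q : Seminorm ℝ 𝔣} (hq : Continuous q) : Continuous (sumSeminorm q) :=
  withSeminorms.continuous_seminorm (⟨q, hq⟩ : {q : Seminorm ℝ 𝔣 // Continuous q})

variable [LieRing 𝔣] [LieAlgebra ℝ 𝔣] [TopologicalSpace 𝔣] [LCLieAlgebra 𝔣]

theorem continuous_monomial (n : ℕ+) : Continuous (monomial n : 𝔣 →ₗ[ℝ] Poly 𝔣) :=
  withSeminorms.continuous_of_continuous_comp _ fun q => by
    have e : ⇑((seminormFamily 𝔣 q).comp (monomial n)) = q.1 :=
      funext fun x => sumSeminorm_monomial q.1 n x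
    rw [e]
    exact q.2

theorem continuous_of_seminorm_le (f : Poly 𝔣 →ₗ[ℝ] 𝔣)
    (h : ∀ (q : Seminorm ℝ 𝔣) X, q (f X) ≤ sumSeminorm q X) : Continuous f := by
  have hG : IsTopologicalAddGroup (Poly 𝔣) := withSeminorms.topologicalAddGroup
  exact (PolynormableSpace.withSeminorms ℝ 𝔣).continuous_of_continuous_comp _ fun q =>
    Seminorm.continuous_of_le (continuous_sumSeminorm q.2) fun X => h q.1 X

theorem continuous_coeff (n : ℕ+) : Continuous (coeff n : Poly 𝔣 →ₗ[ℝ] 𝔣) :=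
  continuous_of_seminorm_le _ fun q X => by
    let X' : ℕ+ →₀ 𝔣 := X
    change q (X' n) ≤ ∑ m ∈ X'.support, q (X' m)
    by_cases hn : n ∈ X'.support
    · exact Finset.single_le_sum (f := fun m => q (X' m)) (fun m _ => apply_nonneg q _) hn
    · rw [Finsupp.notMem_support_iff.1 hn, map_zero]
      exact Finset.sum_nonneg fun m _ => apply_nonneg q _

theorem continuous_eval : Continuous (eval : Poly 𝔣 →ₗ⁅ℝ⁆ 𝔣) :=
  continuous_of_seminorm_le (lift fun _ => LinearMap.id) fun q X =>
    (lift_seminorm_le q _ q 1 (fun _ _ => (one_mul _).ge) X).trans_eq (one_mul _)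

theorem continuous_lift₂ {V ι : Type*} [AddCommGroup V] [Module ℝ V] [TopologicalSpace V]
    {r : SeminormFamily ℝ V ι} (hr : WithSeminorms r) (F : ℕ+ → ℕ+ → 𝔣 →ₗ[ℝ] 𝔣 →ₗ[ℝ] V)
    (h : ∀ i, ∃ (C : ℝ) (p q : Seminorm ℝ 𝔣), Continuous p ∧ Continuous q ∧
      ∀ n m x y, r i (F n m x y) ≤ C * (p x * q y)) :
    Continuous fun v : Poly 𝔣 × Poly 𝔣 => lift₂ F v.1 v.2 := by
  have hG : IsTopologicalAddGroup (Poly 𝔣) := withSeminorms.topologicalAddGroup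
  refine continuous_bilin_of_seminorm_le hr _ fun i => ?_
  obtain ⟨C, p, q, hp, hq, hC⟩ := h i
  exact ⟨C, sumSeminorm p, sumSeminorm q, continuous_sumSeminorm hp, continuous_sumSeminorm hq,
    lift₂_seminorm_le _ F p q C hC⟩

/-- Continuous coefficients separate points, which gives the Hausdorff property. The bracket of
monomials obeys the estimate of the bracket of `𝔣` in every degree, hence is jointly continuous. -/
instance : LCLieAlgebra (Poly 𝔣) where
  toIsTopologicalAddGroup := withSeminorms.topologicalAddGroup
  toContinuousSMul := withSeminorms.continuousSMul
  toLocallyConvexSpace := withSeminorms.toLocallyConvexSpace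
  toT2Space := T2Space.of_injective_continuous (f := fun (X : Poly 𝔣) (n : ℕ+) => coeff n X)
    (fun X Y h => Finsupp.ext (M := 𝔣) fun n => congrFun h n)
    (continuous_pi continuous_coeff)
  continuous_bracket := continuous_lift₂ withSeminorms _ fun r => by
    obtain ⟨p, q, hp, hq, h⟩ := exists_seminorm_bilin_le (lieBilin 𝔣)
      LCLieAlgebra.continuous_bracket r.2
    refine ⟨1, p, q, hp, hq, fun n m x y => ?_⟩
    rw [one_mul]
    exact (sumSeminorm_monomial r.1 (n + m) ⁅x, y⁆).trans_le (h x y)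

/-- The section `a ↦ a x` of the evaluation at `1`. -/
noncomputable def linear : 𝔣 →L[ℝ] Poly 𝔣 := ⟨monomial 1, continuous_monomial 1⟩

theorem eval_linear (x : 𝔣) : eval (linear x) = x := eval_monomial 1 x

/-! ### The bilinear form on polynomial loops that realizes `B`. -/

section Form

variable {𝔞 : Type u} [LieRing 𝔞] [LieAlgebra ℝ 𝔞] [TopologicalSpace 𝔞] [LCLieAlgebra 𝔞]

/-- The bilinear form `(X, Y) ↦ -2 ∫₀¹ B(X'(t), Y(t)) dt`. -/
noncomputable def form (B : 𝔣 →ₗ[ℝ] 𝔣 →ₗ[ℝ] 𝔞) : Poly 𝔣 →ₗ[ℝ] Poly 𝔣 →ₗ[ℝ] 𝔞 :=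
  -- The factor `n / (n + m)` is `∫₀¹ n tⁿ⁻¹ tᵐ dt`.
  lift₂ fun n m => (-2 * ((n : ℝ) / ((n : ℝ) + (m : ℝ)))) • B

theorem form_monomial (B : 𝔣 →ₗ[ℝ] 𝔣 →ₗ[ℝ] 𝔞) (n m : ℕ+) (x y : 𝔣) :
    form B (monomial n x) (monomial m y) = (-2 * ((n : ℝ) / ((n : ℝ) + (m : ℝ)))) • B x y := by
  rw [form, lift₂_monomial, LinearMap.smul_apply, LinearMap.smul_apply]

/-- The factor `n / (n + m)` is at most `1`, so `2` times a bound for `B` serves in all degrees. -/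
theorem continuous_form (B : Sym2Ad 𝔣 𝔞) :
    Continuous fun v : Poly 𝔣 × Poly 𝔣 => form B.1 v.1 v.2 :=
  continuous_lift₂ (PolynormableSpace.withSeminorms ℝ 𝔞) _ fun r => by
    obtain ⟨p, q, hp, hq, h⟩ := exists_seminorm_bilin_le B.1 (Sym2Ad.continuous B) r.2
    refine ⟨2, p, q, hp, hq, fun n m x y => ?_⟩
    have hn : (0 : ℝ) < n := Nat.cast_pos.2 n.pos
    have hm : (0 : ℝ) < m := Nat.cast_pos.2 m.pos
    have h1 : (n : ℝ) / ((n : ℝ) + (m : ℝ)) ≤ 1 := (div_le_one (add_pos hn hm)).2 (by linarith)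
    have h0 : 0 ≤ (n : ℝ) / ((n : ℝ) + (m : ℝ)) := by positivity
    rw [LinearMap.smul_apply, LinearMap.smul_apply, map_smul_eq_mul, norm_mul, norm_neg,
      Real.norm_of_nonneg h0, Real.norm_of_nonneg zero_le_two]
    exact mul_le_mul (by linarith) (h x y) (apply_nonneg _ _) zero_le_two

/-- Integration by parts: the integrand `B(X', Y) + B(Y', X)` is the derivative of `B(X, Y)`, and
the boundary term at `0` vanishes as there are no constant terms. On monomials this is `n/(n+m) +
m/(n+m) = 1`. -/
theorem form_symm (B : Sym2Ad 𝔣 𝔞) (X Y : Poly 𝔣) :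
    (1 / 2 : ℝ) • (form B.1 X Y + form B.1 Y X) = -B.1 (eval X) (eval Y) := by
  refine induction₂ (P := fun X Y => (1 / 2 : ℝ) • (form B.1 X Y + form B.1 Y X) =
    -B.1 (eval X) (eval Y)) X Y (by simp) (by simp)
    (fun X X' Y h h' => ?_) (fun X Y Y' h h' => ?_) fun n x m y => ?_
  · simp only [map_add, LinearMap.add_apply]
    rw [neg_add, ← h, ← h', ← smul_add]
    congr 1
    abel
  · simp only [map_add, LinearMap.add_apply]
    rw [neg_add, ← h, ← h', ← smul_add]
    congr 1
    abel
  · have hn : (0 : ℝ) < n := Nat.cast_pos.2 n.pos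
    have hm : (0 : ℝ) < m := Nat.cast_pos.2 m.pos
    rw [form_monomial, form_monomial, Sym2Ad.symm B y x, eval_monomial, eval_monomial, ← add_smul,
      smul_smul, ← neg_one_smul ℝ (B.1 x y)]
    congr 1
    field_simp
    ring

/-- Expand `[X, Y]' = [X', Y] + [X, Y']`: by invariance the terms with `Y'` cancel and the rest is
`B(X', [Y, Z])`. On monomials all three terms are multiples of `B([x, y], z)`, and `(n+m) - m = n`
over the common denominator. -/
theorem form_lie (B : Sym2Ad 𝔣 𝔞) (X Y Z : Poly 𝔣) :
    form B.1 ⁅X, Y⁆ Z + form B.1 Y ⁅X, Z⁆ = form B.1 X ⁅Y, Z⁆ := by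
  refine induction₂ (P := fun X Y => form B.1 ⁅X, Y⁆ Z + form B.1 Y ⁅X, Z⁆ = form B.1 X ⁅Y, Z⁆)
    X Y (by simp) (by simp) (fun X X' Y h h' => ?_) (fun X Y Y' h h' => ?_) fun n x m y => ?_
  · simp only [add_lie, map_add, LinearMap.add_apply]
    rw [← h, ← h']; abel
  · simp only [lie_add, add_lie, map_add, LinearMap.add_apply]
    rw [← h, ← h']; abel
  · refine induction (P := fun Z => form B.1 ⁅monomial n x, monomial m y⁆ Z +
      form B.1 (monomial m y) ⁅monomial n x, Z⁆ = form B.1 (monomial n x) ⁅monomial m y, Z⁆) Z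
      (by simp) (fun Z Z' h h' => ?_) fun k z => ?_
    · simp only [lie_add, map_add]
      rw [← h, ← h']; abel
    · have h1 := Sym2Ad.invariant B x y z
      have h2 : B.1 y ⁅x, z⁆ = -B.1 ⁅x, y⁆ z := by
        rw [← Sym2Ad.invariant B, ← lie_skew, map_neg, LinearMap.neg_apply]
      have hn : (0 : ℝ) < n := Nat.cast_pos.2 n.pos
      have hm : (0 : ℝ) < m := Nat.cast_pos.2 m.pos
      have hk : (0 : ℝ) < k := Nat.cast_pos.2 k.pos
      rw [lie_monomial, lie_monomial, lie_monomial, form_monomial, form_monomial, form_monomial,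
        h2, ← h1, smul_neg, ← sub_eq_add_neg, ← sub_smul]
      congr 1
      push_cast
      field_simp
      ring

end Form

end Topology

end Poly

section Realization

set_option linter.unusedSectionVars false

variable {𝔣 𝔞 : Type u} [LieRing 𝔣] [LieAlgebra ℝ 𝔣] [TopologicalSpace 𝔣] [LCLieAlgebra 𝔣]
  [LieRing 𝔞] [LieAlgebra ℝ 𝔞] [TopologicalSpace 𝔞] [LCLieAlgebra 𝔞]

/-! ### Realization of invariant symmetric bilinear forms -/

/-- A split extension `p : 𝔤 → 𝔣` with a bilinear form `b` on `𝔤` satisfying the Leibniz rule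
and with symmetric part `-p^* B`. -/
structure Potential (B : Sym2Ad 𝔣 𝔞) (𝔤 : Type u) [LieRing 𝔤] [LieAlgebra ℝ 𝔤]
    [TopologicalSpace 𝔤] where
  p : 𝔤 →ₗ⁅ℝ⁆ 𝔣
  continuous_p : Continuous p
  s : 𝔣 →L[ℝ] 𝔤
  p_s : ∀ x, p (s x) = x
  b : 𝔤 →ₗ[ℝ] 𝔤 →ₗ[ℝ] 𝔞
  continuous_b : Continuous fun v : 𝔤 × 𝔤 => b v.1 v.2
  b_lie : ∀ X Y Z, b ⁅X, Y⁆ Z + b Y ⁅X, Z⁆ = b X ⁅Y, Z⁆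
  b_symm : ∀ X Y, (1 / 2 : ℝ) • (b X Y + b Y X) = -B.1 (p X) (p Y)

/-- The potential on polynomial loops. -/
noncomputable def polyPotential (B : Sym2Ad 𝔣 𝔞) : Potential B (Poly 𝔣) where
  p := Poly.eval
  continuous_p := Poly.continuous_eval
  s := Poly.linear
  p_s := Poly.eval_linear
  b := Poly.form B.1
  continuous_b := Poly.continuous_form B
  b_lie := Poly.form_lie B
  b_symm := Poly.form_symm B

namespace Potential

variable {B : Sym2Ad 𝔣 𝔞} {𝔤 : Type u} [LieRing 𝔤] [LieAlgebra ℝ 𝔤] [TopologicalSpace 𝔤]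
  [LCLieAlgebra 𝔤] (P : Potential B 𝔤)

/-- The kernel of `p`. -/
def kernel : LieSubalgebra ℝ 𝔤 where
  carrier := {X | P.p X = 0}
  add_mem' {X Y} hX hY := by
    change P.p (X + Y) = 0
    rw [map_add, hX, hY, add_zero]
  zero_mem' := map_zero P.p
  smul_mem' c X hX := by
    change P.p (c • X) = 0
    rw [map_smul, hX, smul_zero]
  lie_mem' {X Y} hX hY := by
    change P.p ⁅X, Y⁆ = 0
    rw [LieHom.map_lie, hX, zero_lie]

theorem p_kernel (X : P.kernel) : P.p X = 0 := X.2

/-- The symmetric part `-B(p X, p Y)` vanishes once one argument lies in `ker p`. This makes `b` a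
2-cocycle on the kernel and gives the sign in `η(t x, Y) = -α(Y, x)`. -/
theorem b_skew_of_right (X : 𝔤) {Y : 𝔤} (hY : P.p Y = 0) : P.b Y X = -P.b X Y := by
  have h := P.b_symm X Y
  rw [hY, map_zero, neg_zero, smul_eq_zero] at h
  exact eq_neg_of_add_eq_zero_right (h.resolve_left (by norm_num))

/-- The restriction of `b` to the kernel of `p`. -/
def cocycle : TwoCocycle P.kernel 𝔞 where
  κ := P.b.compl₁₂ P.kernel.incl.toLinearMap P.kernel.incl.toLinearMap
  continuous_κ := P.continuous_b.comp
    ((continuous_subtype_val.comp continuous_fst).prodMk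
      (continuous_subtype_val.comp continuous_snd))
  self X := by
    change P.b (X : 𝔤) (X : 𝔤) = 0
    have h : (2 : ℝ) • P.b (X : 𝔤) (X : 𝔤) = 0 := by
      rw [two_smul]
      nth_rewrite 2 [P.b_skew_of_right _ (P.p_kernel X)]
      exact add_neg_cancel _
    exact (smul_eq_zero.1 h).resolve_left two_ne_zero
  leibniz X Y Z := (P.b_lie (X : 𝔤) Y Z).symm

/-- The total Lie algebra of the crossed module. -/
abbrev Total : Type u := CentralExt P.cocycle

/-- The action of `X` on the total Lie algebra. -/
def act (X : 𝔤) : LieDerivation ℝ P.Total P.Total where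
  toFun y := ⟨⟨⁅X, (y.fst : 𝔤)⁆, by
    change P.p _ = 0
    rw [LieHom.map_lie, P.p_kernel, lie_zero]⟩, P.b X y.fst⟩
  map_add' y z := CentralExt.ext (Subtype.ext (lie_add X (y.fst : 𝔤) z.fst))
    (map_add (P.b X) (y.fst : 𝔤) z.fst)
  map_smul' c y := CentralExt.ext (Subtype.ext (lie_smul c X (y.fst : 𝔤)))
    (map_smul (P.b X) c (y.fst : 𝔤))
  leibniz' y z := by
    refine CentralExt.ext (Subtype.ext ?_) ?_
    · change ⁅X, ⁅(y.fst : 𝔤), (z.fst : 𝔤)⁆⁆ =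
        ⁅(y.fst : 𝔤), ⁅X, (z.fst : 𝔤)⁆⁆ - ⁅(z.fst : 𝔤), ⁅X, (y.fst : 𝔤)⁆⁆
      rw [leibniz_lie, ← lie_skew (z.fst : 𝔤) ⁅X, (y.fst : 𝔤)⁆]
      abel
    · change P.b X ⁅(y.fst : 𝔤), (z.fst : 𝔤)⁆ =
        P.b (y.fst : 𝔤) ⁅X, (z.fst : 𝔤)⁆ - P.b (z.fst : 𝔤) ⁅X, (y.fst : 𝔤)⁆
      rw [← P.b_lie, P.b_skew_of_right _ (P.p_kernel z.fst)]
      abel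

theorem total_ext {y z : P.Total} (h₁ : (y.fst : 𝔤) = z.fst) (h₂ : y.snd = z.snd) : y = z :=
  CentralExt.ext (Subtype.ext h₁) h₂

theorem continuous_mk {S : Type*} [TopologicalSpace S] {f : S → 𝔤} {g : S → 𝔞}
    (hf : ∀ x, P.p (f x) = 0) (hf' : Continuous f) (hg : Continuous g) :
    Continuous fun x => (⟨⟨f x, hf x⟩, g x⟩ : P.Total) :=
  CentralExt.continuous_mk (hf'.subtype_mk hf) hg

theorem continuous_fst_val : Continuous fun y : P.Total => (y.fst : 𝔤) :=
  continuous_subtype_val.comp CentralExt.continuous_fst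

theorem p_sub (X : 𝔤) : P.p (X - P.s (P.p X)) = 0 := by rw [map_sub, P.p_s, sub_self]

/-- The crossed module of a potential. -/
def crossedModule : CrossedModule.{u} where
  𝔥 := P.Total
  𝔤 := 𝔤
  t :=
    { toFun := fun y => (y.fst : 𝔤)
      map_add' := fun _ _ => rfl
      map_smul' := fun _ _ => rfl
      map_lie' := rfl }
  continuous_t := P.continuous_fst_val
  α :=
    { toFun := P.act
      map_add' := fun X Y => LieDerivation.ext fun z =>
        P.total_ext (add_lie X Y (z.fst : 𝔤)) (LinearMap.congr_fun (map_add P.b X Y) _)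
      map_smul' := fun c X => LieDerivation.ext fun z =>
        P.total_ext (smul_lie c X (z.fst : 𝔤)) (LinearMap.congr_fun (map_smul P.b c X) _)
      map_lie' := fun {X Y} => LieDerivation.ext fun z => by
        rw [LieDerivation.lie_apply]
        refine P.total_ext (lie_lie X Y (z.fst : 𝔤)) ?_
        change P.b ⁅X, Y⁆ (z.fst : 𝔤) = P.b X ⁅Y, (z.fst : 𝔤)⁆ - P.b Y ⁅X, (z.fst : 𝔤)⁆
        rw [← P.b_lie, add_sub_cancel_right] }
  continuous_α := P.continuous_mk _
    (continuous_lie continuous_fst (P.continuous_fst_val.comp continuous_snd))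
    (P.continuous_b.comp (continuous_fst.prodMk (P.continuous_fst_val.comp continuous_snd)))
  equivariant _ _ := rfl
  -- The action and the extension cocycle use the same `b`.
  peiffer _ _ := rfl

/-- The splitting `X ↦ (X - s p X, 0)`. -/
def splitting : 𝔤 →L[ℝ] P.Total where
  toFun X := ⟨⟨X - P.s (P.p X), P.p_sub X⟩, 0⟩
  map_add' X Y := P.total_ext
    (by
      change X + Y - P.s (P.p (X + Y)) = X - P.s (P.p X) + (Y - P.s (P.p Y))
      rw [map_add, map_add]; abel)
    (add_zero 0).symm
  map_smul' c X := P.total_ext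
    (by
      change c • X - P.s (P.p (c • X)) = c • (X - P.s (P.p X))
      rw [map_smul, map_smul, smul_sub])
    (smul_zero c).symm
  cont := P.continuous_mk P.p_sub (continuous_id.sub (P.s.continuous.comp P.continuous_p))
    continuous_const

/-- The central, smoothly separable crossed module of a potential. -/
def crMod [IsLieAbelian 𝔞] : CrMod 𝔣 𝔞 where
  toCrossedModule := P.crossedModule
  central X y hy := by
    change (y.fst : 𝔤) = 0 at hy
    refine P.total_ext ?_ ?_
    · revert X
      change ∀ X : 𝔤, ⁅X, (y.fst : 𝔤)⁆ = 0
      intro X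
      rw [hy, lie_zero]
    · change P.b X y.fst = 0
      rw [hy, map_zero]
  separable := by
    refine ⟨P.splitting, fun y => ?_, fun X => P.total_ext ?_ rfl⟩
    · change (y.fst : 𝔤) - P.s (P.p y.fst) = y.fst
      rw [P.p_kernel, map_zero, sub_zero]
    · revert X
      change ∀ X : 𝔤, X - P.s (P.p X) - P.s (P.p (X - P.s (P.p X))) = X - P.s (P.p X)
      intro X
      rw [P.p_sub, map_zero, sub_zero]
  ι :=
    { toFun := fun a => ⟨0, a⟩
      map_add' := fun a b => CentralExt.ext (add_zero 0).symm rfl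
      map_smul' := fun c a => CentralExt.ext (smul_zero c).symm rfl
      map_lie' := fun {a b} => by
        refine CentralExt.ext (zero_lie (0 : P.kernel)).symm ?_
        change ⁅a, b⁆ = P.b 0 0
        -- The copy of `𝔞` is central in the extension, so `ι` is a homomorphism only because `𝔞` is
        -- abelian.
        rw [trivial_lie_zero, map_zero] }
  isEmbedding_ι := Topology.IsEmbedding.of_leftInverse (f := CentralExt.snd) (fun _ => rfl)
    CentralExt.continuous_snd (CentralExt.continuous_mk continuous_const continuous_id)
  range_ι y := by
    constructor
    · rintro ⟨a, rfl⟩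
      rfl
    · intro hy
      exact ⟨y.snd, P.total_ext (Eq.symm hy) rfl⟩
  p := P.p
  isQuotientMap_p := Topology.IsQuotientMap.of_inverse P.s.continuous P.continuous_p P.p_s
  ker_p X := by
    constructor
    · intro hX
      exact ⟨⟨⟨X, hX⟩, 0⟩, rfl⟩
    · rintro ⟨y, rfl⟩
      exact P.p_kernel y.fst

/-- The bilinear map `(X, Y) ↦ ([X, Y] - s p [X, Y], b(X, Y))`. -/
def adjustmentForm : 𝔤 →ₗ[ℝ] 𝔤 →ₗ[ℝ] P.Total :=
  LinearMap.mk₂ ℝ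
    (fun X Y : 𝔤 => (⟨⟨⁅X, Y⁆ - P.s (P.p ⁅X, Y⁆), P.p_sub _⟩, P.b X Y⟩ : P.Total))
    (fun X X' Y => P.total_ext
      (by
        change ⁅X + X', Y⁆ - P.s (P.p ⁅X + X', Y⁆) =
          ⁅X, Y⁆ - P.s (P.p ⁅X, Y⁆) + (⁅X', Y⁆ - P.s (P.p ⁅X', Y⁆))
        rw [add_lie, map_add, map_add]; abel)
      (LinearMap.congr_fun (map_add P.b X X') Y))
    (fun c X Y => P.total_ext
      (by
        change ⁅c • X, Y⁆ - P.s (P.p ⁅c • X, Y⁆) = c • (⁅X, Y⁆ - P.s (P.p ⁅X, Y⁆))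
        rw [smul_lie, map_smul, map_smul, smul_sub])
      (LinearMap.congr_fun (map_smul P.b c X) Y))
    (fun X Y Y' => P.total_ext
      (by
        change ⁅X, Y + Y'⁆ - P.s (P.p ⁅X, Y + Y'⁆) =
          ⁅X, Y⁆ - P.s (P.p ⁅X, Y⁆) + (⁅X, Y'⁆ - P.s (P.p ⁅X, Y'⁆))
        rw [lie_add, map_add, map_add]; abel)
      (map_add (P.b X) Y Y'))
    (fun c X Y => P.total_ext
      (by
        change ⁅X, c • Y⁆ - P.s (P.p ⁅X, c • Y⁆) = c • (⁅X, Y⁆ - P.s (P.p ⁅X, Y⁆))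
        rw [lie_smul, map_smul, map_smul, smul_sub])
      (map_smul (P.b X) c Y))

/-- The adapted adjustment of a potential. -/
def adjustment [IsLieAbelian 𝔞] : AdaptedAdjustment P.crMod where
  η := P.adjustmentForm
  continuous_η := by
    have hb : Continuous fun v : 𝔤 × 𝔤 => ⁅v.1, v.2⁆ := continuous_lie continuous_fst continuous_snd
    exact P.continuous_mk (fun v : 𝔤 × 𝔤 => P.p_sub ⁅v.1, v.2⁆)
      (hb.sub (P.s.continuous.comp (P.continuous_p.comp hb))) P.continuous_b
  η_lie X Y Z := by
    refine P.total_ext ?_ (P.b_lie X Y Z)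
    revert X Y Z
    change ∀ X Y Z : 𝔤, ⁅⁅X, Y⁆, Z⁆ - P.s (P.p ⁅⁅X, Y⁆, Z⁆) +
      (⁅Y, ⁅X, Z⁆⁆ - P.s (P.p ⁅Y, ⁅X, Z⁆⁆)) = ⁅X, ⁅Y, Z⁆⁆ - P.s (P.p ⁅X, ⁅Y, Z⁆⁆)
    intro X Y Z
    rw [leibniz_lie X, map_add, map_add]
    abel
  η_t_left y Y := by
    refine P.total_ext ?_ (P.b_skew_of_right Y (P.p_kernel y.fst))
    revert Y
    change ∀ Y : 𝔤, ⁅(y.fst : 𝔤), Y⁆ - P.s (P.p ⁅(y.fst : 𝔤), Y⁆) = -⁅Y, (y.fst : 𝔤)⁆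
    intro Y
    rw [LieHom.map_lie, P.p_kernel, zero_lie, map_zero, sub_zero, lie_skew]
  η_t_right X y := by
    refine P.total_ext ?_ rfl
    revert X
    change ∀ X : 𝔤, ⁅X, (y.fst : 𝔤)⁆ - P.s (P.p ⁅X, (y.fst : 𝔤)⁆) = ⁅X, (y.fst : 𝔤)⁆
    intro X
    rw [LieHom.map_lie, P.p_kernel, lie_zero, map_zero, sub_zero]
  s := P.s
  isSection := P.p_s
  adapted _ _ := rfl

/-- The `ker p` component of `η` is skew, so the symmetric part is that of `b` alone. -/
theorem adjustedKL_adjustment [IsLieAbelian 𝔞] : P.adjustment.adjustedKL = B := by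
  refine AdaptedAdjustment.adjustedKL_unique _ fun X Y => P.total_ext ?_ (P.b_symm X Y)
  revert X Y
  change ∀ X Y : 𝔤, (1 / 2 : ℝ) • (⁅X, Y⁆ - P.s (P.p ⁅X, Y⁆) + (⁅Y, X⁆ - P.s (P.p ⁅Y, X⁆))) = -0
  intro X Y
  rw [← lie_skew X Y, map_neg, map_neg, ← neg_sub', neg_add_cancel, smul_zero, neg_zero]

end Potential

end Realization

end AdjKL

/-! ### Assembly of the classification. -/

open AdjKL in
theorem mainTheorem5 {𝔣 𝔞 : Type u}
    [LieRing 𝔣] [LieAlgebra ℝ 𝔣] [TopologicalSpace 𝔣] [AdjKL.LCLieAlgebra 𝔣]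
    [LieRing 𝔞] [LieAlgebra ℝ 𝔞] [TopologicalSpace 𝔞] [AdjKL.LCLieAlgebra 𝔞]
    [IsLieAbelian 𝔞] :
    ∃ (KLadj : AdjKL.AdjCrMod.Pi0 𝔣 𝔞 → AdjKL.Sym2Ad 𝔣 𝔞)
      (KL : AdjKL.CrMod.Pi0 𝔣 𝔞 → AdjKL.H3 𝔣 𝔞),
      (∀ X : AdjKL.AdjCrMod 𝔣 𝔞, KLadj (Quot.mk _ X) = X.adj.adjustedKL) ∧
      (∀ (G : AdjKL.CrMod 𝔣 𝔞) (u : G.𝔤 →L[ℝ] G.𝔥) (hu : G.IsHalfSplitting u),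
        KL (Quot.mk _ G) = G.klClass u hu) ∧
      Function.Bijective KLadj ∧
      Function.Injective KL ∧
      (∀ x, AdjKL.cw (KLadj x) = KL (AdjKL.AdjCrMod.forget 𝔣 𝔞 x)) ∧
      (∀ X Y : AdjKL.AdjCrMod 𝔣 𝔞,
        Nonempty (AdjKL.AdjCrMod.Mor X Y) ↔ X.adj.adjustedKL = Y.adj.adjustedKL) := by
  let KLadj : AdjCrMod.Pi0 𝔣 𝔞 → Sym2Ad 𝔣 𝔞 :=
    Quot.lift (fun X => X.adj.adjustedKL) fun _ _ ⟨m⟩ => m.adjustedKL_eq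
  let KL : CrMod.Pi0 𝔣 𝔞 → H3 𝔣 𝔞 :=
    -- The definition uses some chosen splitting; `hKL` shows that any half splitting gives the same
    -- value.
    Quot.lift (fun G => G.klClass _ G.separable.choose_spec.1) fun _ _ ⟨m⟩ => m.klClass_eq _ _
  have hKL : ∀ (G : CrMod 𝔣 𝔞) (u : G.𝔤 →L[ℝ] G.𝔥) (hu : G.IsHalfSplitting u),
      KL (Quot.mk _ G) = G.klClass u hu := fun G u hu => CrMod.klClass_eq _ hu
  refine ⟨KLadj, KL, fun _ => rfl, hKL, ⟨?_, fun B => ?_⟩, ?_, ?_, fun X Y =>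
    ⟨fun ⟨m⟩ => m.adjustedKL_eq, AdjCrMod.nonempty_mor_of_adjustedKL_eq⟩⟩
  · rintro ⟨X⟩ ⟨Y⟩ h
    exact Quot.sound (AdjCrMod.nonempty_mor_of_adjustedKL_eq h)
  · exact ⟨Quot.mk _ ⟨_, (polyPotential B).adjustment⟩, (polyPotential B).adjustedKL_adjustment⟩
  · rintro ⟨G₁⟩ ⟨G₂⟩ h
    exact Quot.sound (CrMod.nonempty_mor_of_klClass_eq _ _ h)
  · rintro ⟨X⟩
    exact X.adj.cw_adjustedKL _
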